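/- **Setting.** For $N\ge 2$ let $U=SC$ be the walk operator on $\mathbb C^{\mathbb Z/N}\otimes\mathbb C^2$ (basis $|x\rangle\otimes|{\leftarrow}\rangle,\ |x\rangle\otimes|{\rightarrow}\rangle$), where $S(|x\rangle\otimes|{\leftarrow}\rangle)=|x-1\rangle\otimes|{\leftarrow}\rangle$, $S(|x\rangle\otimes|{\rightarrow}\rangle)=|x+1\rangle\otimes|{\rightarrow}\rangle$ and $C=\sum_x|x\rangle\langle x|\otimes A$. The Hadamard walk of M type on $C_N$ has $A=\frac1{\sqrt2}\begin{pmatrix}1&1\\1&-1\end{pmatrix}$, that of F type has $A=\frac1{\sqrt2}\begin{pmatrix}1&-1\\1&1\end{pmatrix}$. The zeta function of the walk is $f(u)=\det(I-uU)^{-1}$, with values in $\mathbb C\cup\{\infty\}$. A function $f:\mathbb R\to\mathbb C\cup\{\infty\}$ is an *absolute automorphic form* of weight $D\in\mathbb Z$ if, for some $C\in\{1,-1\}$, $f(1/x)=Cx^{-D}f(x)$ for all real $x\ne0$. Put $$Z_f(w,s)=\frac1{\Gamma(w)}\int_1^\infty f(x)x^{-s-1}(\log x)^{w-1}\,dx,\qquad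 \zeta_f(s)=\exp\Bigl(\tfrac{\partial}{\partial w}Z_f(w,s)\big|_{w=0}\Bigr),$$ where $Z_f$ is continued meromorphically in $w$ and then $\zeta_f$ is continued meromorphically in $s$ to $\mathbb C$. For $\omega=(\omega_1,\dots,\omega_r)$ with $\omega_i>0$ put $$\zeta_r(w,x,\omega)=\sum_{k_1,\dots,k_r\ge0}(k_1\omega_1+\dots+k_r\omega_r+x)^{-w}$$ (principal powers, continued meromorphically in $w$), $\Gamma_r(x,\omega)=\exp\bigl(\frac{\partial}{\partial w}\zeta_r(w,x,\omega)|_{w=0}\bigr)$ and $S_r(x,\omega)=\Gamma_r(x,\omega)^{-1}\,\Gamma_r(\omega_1+\dots+\omega_r-x,\omega)^{(-1)^r}$. The functions $\Gamma_r(x,\omega)$ are considered for $x\notin P_\omega=\{-(k_1\omega_1+\dots+k_r\omega_r):k_i\in\mathbb Z_{\ge0}\}$, and $S_r(x,\omega)$ where both of its factors are. **Theorem.** Consider the six walks with the data $m=(m(1),\dots,m(a))$, $n=(n(1),\dots,n(b))$, $D$ in the table: | type | $N$ | $m$ | $n$ | $D$ | |---|---|---|---|---| | M | 2 | empty ($a=0$)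 | $(2,2)$ | $-4$ | | M | 4 | $(4)$ | $(2,2,8)$ | $-8$ | | M | 8 | $(4,4,4,6,6)$ | $(2,2,2,2,8,12,12)$ | $-16$ | | F | 2 | $(4)$ | $(8)$ | $-4$ | | F | 4 | $(2,2)$ | $(4,8)$ | $-8$ | | F | 8 | $(2,2,2,2)$ | $(4,6,6,8)$ | $-16$ | For each of them, with $f$ the zeta function of the walk and $m(I)=\sum_{i\in I}m(i)$ for $I\subseteq\{1,\dots,a\}$: 1. $\displaystyle f(u)=\frac{\prod_{i=1}^a(u^{m(i)}-1)}{\prod_{j=1}^b(u^{n(j)}-1)}$ for all $u\in\mathbb C$ at which the denominator does not vanish. 2. $f$, restricted to $\mathbb R$, is an absolute automorphic form of weight $D$. 3. For $x\notin P_n$ the series $\zeta_b(w,x,n)$ converges absolutely for $\operatorname{Re}w>b$ and continues meromorphically to $w\in\mathbb C$, with no pole outside $\{1,\dots,b\}$. For $\operatorname{Re}s>D$ the integral for $Z_f(w,s)$ converges absolutely when $\operatorname{Re}w>b-a$ and continues meromorphically to $w\in\mathbb C$, holomorphically at $w=0$. For $\operatorname{Re}s>D$ and $w\notin\{1,\dots,b\}$,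 $$Z_f(w,s)=\sum_{I\subseteq\{1,\dots,a\}}(-1)^{|I|}\,\zeta_b\bigl(w,\,s-D+m(I),\,n\bigr),$$ and for each such $w$ the right-hand side is holomorphic in $s\in\mathbb C\setminus(-\infty,D]$. 4. The function $\zeta_f(s)$, defined by the formula above for $\operatorname{Re}s>D$, continues meromorphically to $\mathbb C$, and $$\zeta_f(s)=\prod_{I\subseteq\{1,\dots,a\}}\Gamma_b\bigl(s-D+m(I),\,n\bigr)^{(-1)^{|I|}}$$ for all $s$ at which all the factors are defined. 5. For all $s$ at which all the multiple sine factors are defined, $$\zeta_f(D-s)=\Bigl(\prod_{I\subseteq\{1,\dots,a\}}S_b\bigl(s-D+m(I),\,n\bigr)^{(-1)^{|I|}}\Bigr)\zeta_f(s).$$ Moreover, for the F-type walk on $C_2$, $$\zeta_f(s)=\frac{\Gamma\left(\frac{s+4}8\right)}{\Gamma\left(\frac{s+8}8\right)}\cdot 8^{-1/2}\qquad(s\notin\{-4-8k:k\in\mathbb Z_{\ge0}\}),$$ with $1/\Gamma=0$ at the poles of $\Gamma$, and $\zeta_f(-4-s)=-\cot\left(\frac{\pi s}8\right)\zeta_f(s)$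 for $s\notin 8\mathbb Z\cup\{-4-8k:k\in\mathbb Z_{\ge0}\}$. -/

import Mathlib

open scoped Topology Kronecker

noncomputable section

namespace AbsZeta

/-! ### Meromorphic continuation from a right half-plane -/

/-- `G` is the meromorphic continuation to `ℂ` of the function `F`, which is considered on some
right half-plane. "Normal form" means that removable singularities are filled in and that the
value assigned at a pole is `0`, so that `G` is a determined function on all of `ℂ`. -/
def IsMeroContinuation (F G : ℂ → ℂ) : Prop :=
  MeromorphicNFOn G Set.univ ∧ ∃ σ : ℝ, ∀ z : ℂ, σ < z.re → G z = F z

/-- The meromorphic continuation is unique. -/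
theorem IsMeroContinuation.unique {F G H : ℂ → ℂ}
    (hG : IsMeroContinuation F G) (hH : IsMeroContinuation F H) : G = H := by
  obtain ⟨hG1, σ, hG2⟩ := hG
  obtain ⟨hH1, τ, hH2⟩ := hH
  have hm : MeromorphicOn (G - H) Set.univ := hG1.meromorphicOn.sub hH1.meromorphicOn
  have hz : meromorphicOrderAt (G - H) ((max σ τ + 1 : ℝ) : ℂ) = ⊤ := by
    rw [meromorphicOrderAt_eq_top_iff]
    refine Filter.Eventually.filter_mono nhdsWithin_le_nhds ?_
    have ho : IsOpen {z : ℂ | max σ τ < z.re} := isOpen_lt continuous_const Complex.continuous_re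
    have hmem : ((max σ τ + 1 : ℝ) : ℂ) ∈ {z : ℂ | max σ τ < z.re} := by
      simp only [Set.mem_ofPred_eq, Complex.ofReal_re]
      linarith
    filter_upwards [ho.mem_nhds hmem] with z hz
    have h1 : σ < z.re := lt_of_le_of_lt (le_max_left _ _) hz
    have h2 : τ < z.re := lt_of_le_of_lt (le_max_right _ _) hz
    simp [hG2 z h1, hH2 z h2]
  funext x
  have hx : meromorphicOrderAt (G - H) x = ⊤ := by
    by_contra hne
    exact MeromorphicOn.meromorphicOrderAt_ne_top_of_isPreconnected hm
      isPreconnected_univ (Set.mem_univ x) (Set.mem_univ _) hne hz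
  rw [meromorphicOrderAt_eq_top_iff] at hx
  have he : G =ᶠ[𝓝[≠] x] H := by
    filter_upwards [hx] with z hz
    exact sub_eq_zero.mp hz
  exact ((MeromorphicNFAt.eventuallyEq_nhdsNE_iff_eventuallyEq_nhds (hG1 (Set.mem_univ x))
    (hH1 (Set.mem_univ x))).1 he).eq_of_nhds

open Classical in
/-- The meromorphic continuation of `F` from a right half-plane (`0` if there is none). -/
def meroContinuation (F : ℂ → ℂ) : ℂ → ℂ :=
  if h : ∃ G, IsMeroContinuation F G then h.choose else 0

/-! ### Absolute automorphic forms, absolute Hurwitz zeta and absolute zeta functions -/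

/-- `f : ℝ → ℂ ∪ {∞}` is an absolute automorphic form of weight `D`:
`f (1 / x) = C x ^ (-D) f x` with `C ∈ {-1, 1}`. Multiplication by the nonzero number
`C x ^ (-D)` fixes `∞`. -/
def IsAbsAutomorphic (f : ℝ → OnePoint ℂ) (D : ℤ) : Prop :=
  ∃ C : ℂ, (C = -1 ∨ C = 1) ∧
    ∀ x : ℝ, x ≠ 0 → f (1 / x) = (f x).map (fun z => C * (x : ℂ) ^ (-D) * z)

/-- The integrand `f(x) x^{-s-1} (log x)^{w-1}`; the value of `f` at a pole is irrelevant. -/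
def absHurwitzIntegrand (f : ℝ → OnePoint ℂ) (w s : ℂ) (x : ℝ) : ℂ :=
  (f x).elim 0 id * (x : ℂ) ^ (-s - 1) * (Real.log x : ℂ) ^ (w - 1)

/-- `(1 / Γ(w)) ∫_1^∞ f(x) x^{-s-1} (log x)^{w-1} dx`. -/
def absHurwitzIntegral (f : ℝ → OnePoint ℂ) (w s : ℂ) : ℂ :=
  1 / Complex.Gamma w * ∫ x in Set.Ioi (1 : ℝ), absHurwitzIntegrand f w s x

/-- The absolute Hurwitz zeta function `Z_f(w, s)`: the integral, continued meromorphically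
in `w` for each fixed `s`. -/
def absHurwitz (f : ℝ → OnePoint ℂ) (w s : ℂ) : ℂ :=
  meroContinuation (fun w' => absHurwitzIntegral f w' s) w

/-- `exp (∂/∂w Z_f(w, s) |_{w = 0})`, for `s` in the half-plane where `Z_f(w, s)` is given
by an integral. -/
def absZetaHalfPlane (f : ℝ → OnePoint ℂ) (s : ℂ) : ℂ :=
  Complex.exp (deriv (fun w => absHurwitz f w s) 0)

/-- The absolute zeta function `ζ_f(s)`, as a meromorphic function on `ℂ`. -/
def absZeta (f : ℝ → OnePoint ℂ) : ℂ → ℂ :=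
  meroContinuation (absZetaHalfPlane f)

/-! ### Multiple Hurwitz zeta, gamma and sine functions -/

/-- The multiple series `∑_{n_1, …, n_r ≥ 0} (n_1 ω_1 + ⋯ + n_r ω_r + x)^{-w}`. -/
def multHurwitzSeries {r : ℕ} (w x : ℂ) (ω : Fin r → ℝ) : ℂ :=
  ∑' k : Fin r → ℕ, ((∑ i, (k i : ℂ) * (ω i : ℂ)) + x) ^ (-w)

/-- The multiple Hurwitz zeta function `ζ_r(w, x, ω)`, continued meromorphically in `w`. -/
def multHurwitz {r : ℕ} (w x : ℂ) (ω : Fin r → ℝ) : ℂ :=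
  meroContinuation (fun w' => multHurwitzSeries w' x ω) w

/-- The multiple gamma function `Γ_r(x, ω) = exp (∂/∂w ζ_r(w, x, ω) |_{w = 0})`.
Finitely many terms of the series have nonpositive real part, and for those another branch of the
logarithm changes the derivative at `0` by a multiple of `2πi`; hence this value is the right one
for every `x` outside the pole set. -/
def multGamma {r : ℕ} (x : ℂ) (ω : Fin r → ℝ) : ℂ :=
  Complex.exp (deriv (fun w => multHurwitz w x ω) 0)

/-- The multiple sine function
`S_r(x, ω) = Γ_r(x, ω)^{-1} Γ_r(ω_1 + ⋯ + ω_r - x, ω)^{(-1)^r}`. -/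
def multSine {r : ℕ} (x : ℂ) (ω : Fin r → ℝ) : ℂ :=
  (multGamma x ω)⁻¹ * (multGamma ((∑ i, (ω i : ℂ)) - x) ω) ^ ((-1 : ℤ) ^ r)

/-- The points `x = -(k_1 ω_1 + ⋯ + k_r ω_r)`, `k_i ≥ 0`, where a term of the series is the power
of zero: the poles of `Γ_r(·, ω)`. -/
def multGammaPoles {r : ℕ} (ω : Fin r → ℝ) : Set ℂ :=
  {x | ∃ k : Fin r → ℕ, (∑ i, (k i : ℂ) * (ω i : ℂ)) + x = 0}

/-! ### Hadamard walks on cycles -/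

/-- The displacement of the two chiralities: `0` stands for `←` and `1` for `→`. -/
def step (N : ℕ) : Fin 2 → ZMod N := ![-1, 1]

/-- The shift operator: `|x⟩ ⊗ |←⟩ ↦ |x - 1⟩ ⊗ |←⟩`, `|x⟩ ⊗ |→⟩ ↦ |x + 1⟩ ⊗ |→⟩`. -/
def shiftOp (N : ℕ) : Matrix (ZMod N × Fin 2) (ZMod N × Fin 2) ℂ :=
  Matrix.of fun p q => if p.1 = q.1 + step N q.2 ∧ p.2 = q.2 then 1 else 0

/-- The coin operator `∑ₓ |x⟩⟨x| ⊗ A`. -/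
def coinOp (N : ℕ) (A : Matrix (Fin 2) (Fin 2) ℂ) :
    Matrix (ZMod N × Fin 2) (ZMod N × Fin 2) ℂ :=
  (1 : Matrix (ZMod N) (ZMod N) ℂ) ⊗ₖ A

/-- The time-evolution operator `U = S C` of the walk on `C_N` with local coin operator `A`. -/
def evolution (N : ℕ) [NeZero N] (A : Matrix (Fin 2) (Fin 2) ℂ) :
    Matrix (ZMod N × Fin 2) (ZMod N × Fin 2) ℂ :=
  shiftOp N * coinOp N A

/-- The local coin operator of the M-type Hadamard walk. -/
def coinM : Matrix (Fin 2) (Fin 2) ℂ := (1 / (Real.sqrt 2 : ℂ)) • !![1, 1; 1, -1]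

/-- The local coin operator of the F-type Hadamard walk. -/
def coinF : Matrix (Fin 2) (Fin 2) ℂ := (1 / (Real.sqrt 2 : ℂ)) • !![1, -1; 1, 1]

open Classical in
/-- The zeta function `u ↦ det(I - uU)^{-1}` of a walk, with values in `ℂ ∪ {∞}`. -/
def walkZeta (N : ℕ) [NeZero N] (A : Matrix (Fin 2) (Fin 2) ℂ) (u : ℂ) : OnePoint ℂ :=
  if (1 - u • evolution N A).det = 0 then OnePoint.infty
  else (((1 - u • evolution N A).det)⁻¹ : ℂ)

/-! ### The assertions -/

/-- The multiple Hurwitz zeta function of order `r` with parameters `ω` is well defined: for every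
`x` outside the pole set, the series converges absolutely for `Re w > r`, and it has a meromorphic
continuation to `ℂ`, which is given by the series for `Re w > r` and has no pole outside
`{1, …, r}`. -/
def MultHurwitzWellDefined {r : ℕ} (ω : Fin r → ℝ) : Prop :=
  ∀ x : ℂ, x ∉ multGammaPoles ω →
    (∀ w : ℂ, (r : ℝ) < w.re →
      Summable (fun k : Fin r → ℕ => ((∑ i, (k i : ℂ) * (ω i : ℂ)) + x) ^ (-w)) ∧
      multHurwitz w x ω = multHurwitzSeries w x ω) ∧
    IsMeroContinuation (fun w => multHurwitzSeries w x ω) (fun w => multHurwitz w x ω) ∧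
    ∀ w : ℂ, (∀ j ∈ Finset.Icc 1 r, w ≠ (j : ℂ)) → AnalyticAt ℂ (fun w' => multHurwitz w' x ω) w

/-- The argument `s - D + m(I)`, where `m(I) = ∑_{i ∈ I} m(i)`. -/
def arg {a : ℕ} (D : ℤ) (m : Fin a → ℕ) (s : ℂ) (I : Finset (Fin a)) : ℂ :=
  s - (D : ℂ) + ∑ i ∈ I, (m i : ℂ)

/-- The parameter vector `(n(1), …, n(b))` as a vector of real numbers. -/
def params {b : ℕ} (n : Fin b → ℕ) : Fin b → ℝ := fun j => (n j : ℝ)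

/-- The alternating sum `∑_I (-1)^{|I|} ζ_b(w, s - D + m(I), n)` over all `I ⊆ {1, …, a}`. -/
def altHurwitzSum {a b : ℕ} (m : Fin a → ℕ) (n : Fin b → ℕ) (D : ℤ) (w s : ℂ) : ℂ :=
  ∑ I : Finset (Fin a), (-1 : ℂ) ^ I.card * multHurwitz w (arg D m s I) (params n)

/-- The assertions about `F : ℂ → ℂ ∪ {∞}` (restricted to the real line where absolute zeta
functions are concerned), exponents `m(1), …, m(a)` and `n(1), …, n(b)`, and the weight `D`. -/
structure ExplicitAbsZeta (F : ℂ → OnePoint ℂ) {a b : ℕ} (m : Fin a → ℕ) (n : Fin b → ℕ)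
    (D : ℤ) : Prop where
  /-- `F(u) = ∏ (u^{m(i)} - 1) / ∏ (u^{n(j)} - 1)`. -/
  quotient : ∀ u : ℂ, ∏ j, (u ^ n j - 1) ≠ 0 →
    F u = (((∏ i, (u ^ m i - 1)) / ∏ j, (u ^ n j - 1) : ℂ) : OnePoint ℂ)
  /-- absolute automorphic form of weight `D` -/
  automorphic : IsAbsAutomorphic (fun x : ℝ => F x) D
  /-- the multiple zeta functions in the formulas are well defined -/
  multHurwitz_wellDefined : MultHurwitzWellDefined (params n)
  /-- the integral converges absolutely for `Re s > D`, `Re w > b - a`, and equals `Z_f(w, s)` -/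
  convergence : ∀ w s : ℂ, (b : ℝ) - (a : ℝ) < w.re → (D : ℝ) < s.re →
    MeasureTheory.IntegrableOn (absHurwitzIntegrand (fun x : ℝ => F x) w s) (Set.Ioi 1) ∧
    absHurwitz (fun x : ℝ => F x) w s = absHurwitzIntegral (fun x : ℝ => F x) w s
  /-- `Z_f(w, s)` is meromorphic in `w ∈ ℂ` and holomorphic at `w = 0` -/
  continuation : ∀ s : ℂ, (D : ℝ) < s.re →
    IsMeroContinuation (fun w => absHurwitzIntegral (fun x : ℝ => F x) w s)
      (fun w => absHurwitz (fun x : ℝ => F x) w s) ∧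
    AnalyticAt ℂ (fun w => absHurwitz (fun x : ℝ => F x) w s) 0
  /-- `Z_f(w, s)` is the alternating sum of multiple Hurwitz zeta functions -/
  hurwitz : ∀ w s : ℂ, (∀ j ∈ Finset.Icc 1 b, w ≠ (j : ℂ)) → (D : ℝ) < s.re →
    absHurwitz (fun x : ℝ => F x) w s = altHurwitzSum m n D w s
  /-- the alternating sum is holomorphic in `s ∈ ℂ \ (-∞, D]`; hence the formula persists for the
  analytic continuation of `Z_f(w, s)` in `s` -/
  hurwitz_continued : ∀ w : ℂ, (∀ j ∈ Finset.Icc 1 b, w ≠ (j : ℂ)) →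
    DifferentiableOn ℂ (fun s => altHurwitzSum m n D w s) {s | s - (D : ℂ) ∈ Complex.slitPlane}
  /-- `ζ_f` is meromorphic on `ℂ`, and `ζ_f(s) = exp (∂/∂w Z_f(w, s) |_{w = 0})` for `Re s > D` -/
  zeta_continuation :
    IsMeroContinuation (absZetaHalfPlane (fun x : ℝ => F x)) (absZeta (fun x : ℝ => F x)) ∧
    ∀ s : ℂ, (D : ℝ) < s.re →
      absZeta (fun x : ℝ => F x) s = absZetaHalfPlane (fun x : ℝ => F x) s
  /-- `ζ_f(s) = ∏_I Γ_b(s - D + m(I), n)^{(-1)^{|I|}}` wherever the factors are defined -/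
  zeta : ∀ s : ℂ, (∀ I : Finset (Fin a), arg D m s I ∉ multGammaPoles (params n)) →
    absZeta (fun x : ℝ => F x) s =
      ∏ I : Finset (Fin a), (multGamma (arg D m s I) (params n)) ^ ((-1 : ℤ) ^ I.card)
  /-- `ζ_f(D - s) = (∏_I S_b(s - D + m(I), n)^{(-1)^{|I|}}) ζ_f(s)` wherever the multiple sine
  factors are defined -/
  functional_equation : ∀ s : ℂ,
    (∀ I : Finset (Fin a), arg D m s I ∉ multGammaPoles (params n) ∧
      (∑ j, (params n j : ℂ)) - arg D m s I ∉ multGammaPoles (params n)) →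
    absZeta (fun x : ℝ => F x) ((D : ℂ) - s) =
      (∏ I : Finset (Fin a), (multSine (arg D m s I) (params n)) ^ ((-1 : ℤ) ^ I.card)) *
        absZeta (fun x : ℝ => F x) s

end AbsZeta

end

/-!
The zeta function of each walk is a quotient of products of polynomials `u ^ k - 1`: the discrete
Fourier transform on `ℤ/N` splits `1 - u U` into `2 × 2` blocks (`det_one_sub_evolution`), and the
resulting products over the `N`-th roots of unity, `N = 2, 4, 8`, are reciprocal polynomials in
`u`, which is the functional equation under `u ↦ 1 / u`.

Everything analytic rests on one continuation result. Let `Q` be continuous on `(0, ∞)`, bounded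
near infinity, with a pole of order at most `c` at `0`, and consider
`Γ(w)⁻¹ ∫ e^{-yt} Q(t) t^{w-1} dt` for `Re y > 0`, `Re w > c`. Subtracting `c + n` terms of the
Laurent expansion of `Q` at `0` and integrating them explicitly continues the integral to
`Re w > -n` (`lapExt`); the pieces agree on overlaps (`HasLaurentBound.lapExt_succ`), so they glue
to a function `lapCont` that is analytic in `w` off `{1, …, c}`, is holomorphic in `y`, and whose
derivative at `w = 0` is explicit and holomorphic in `y` (`lapDeriv`). The normal form of a
meromorphic continuation being unique, `meroContinuation_spec` identifies the abstractly defined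
continuations with such explicit ones.

* For the multiple Hurwitz zeta function at `x` with `Re x > -σ`, the finitely many terms with
  `kω < σ` are split off, and the rest of the series is an integral of the above type with
  `y = x + σ` (`lapMellin_truncGeom`). Hence `Γ_r` is, on this half-plane, a zero-free
  holomorphic function times finitely many factors `(kω + x)⁻¹` (`multGamma_eq_gammaExt`); in
  particular it is meromorphic on `ℂ`.
* The substitution `x = e^t` turns `Z_f(w, s)` into an integral of the above type with
  `Q(t) = ∏ (1 - e^{-m(i)t}) / ∏ (1 - e^{-n(j)t})`, `c = b - a` and `y = s - D`. Expanding the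
  numerator gives the alternating sum of multiple Hurwitz zeta functions for `Re w > b`, and the
  identity theorem gives it everywhere (`absHurwitz_eq_altHurwitzSum`). Differentiating at `w = 0`
  yields the product of multiple gamma functions, which continues `ζ_f`.
* Since `D = ∑ m(i) - ∑ n(j)`, replacing `s` by `D - s` exchanges the index set `I` with its
  complement in the reflected arguments of the multiple sine functions; as `a + b` is even the
  signs match and the functional equation is a cancellation (`gammaProd_reflect`).

For the F-type walk on the cycle of length two, `g(s + 4) = ζ_f(s)` satisfies
`g(y) g(y + 4) = 1 / y` and `g(y) ~ y^{-1/2}` along `y + 8ℕ`. Iterating the first relation and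
comparing with Euler's product for `Γ` determines `g` (`exp_lapDeriv_eq_Gamma`), and the cotangent
comes from the reflection formula.
-/

noncomputable section

namespace AbsZeta

open Filter Set MeasureTheory

/-! ### Meromorphic continuation -/

theorem IsMeroContinuation.meroContinuation_eq {F G : ℂ → ℂ} (h : IsMeroContinuation F G) :
    meroContinuation F = G := by
  have hex : ∃ G, IsMeroContinuation F G := ⟨G, h⟩
  rw [meroContinuation, dif_pos hex]
  exact hex.choose_spec.unique h

/-- Passing to the normal form does not change the germ at a point of analyticity. -/
theorem toMeromorphicNFOn_eventuallyEq {G : ℂ → ℂ} (hG : MeromorphicOn G univ) {z : ℂ}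
    (hz : AnalyticAt ℂ G z) : toMeromorphicNFOn G univ =ᶠ[𝓝 z] G :=
  (MeromorphicNFAt.eventuallyEq_nhdsNE_iff_eventuallyEq_nhds
    (meromorphicNFOn_toMeromorphicNFOn G univ (mem_univ z)) hz.meromorphicNFAt).1
    (hG.toMeromorphicNFOn_eq_self_on_nhdsNE (mem_univ z))

/-- A meromorphic function that is analytic and equal to `F` on a right half-plane computes the
meromorphic continuation of `F` wherever it is analytic. -/
theorem meroContinuation_spec {F G : ℂ → ℂ} (hG : MeromorphicOn G univ) (σ : ℝ)
    (ha : ∀ z : ℂ, σ < z.re → AnalyticAt ℂ G z) (hFG : ∀ z : ℂ, σ < z.re → G z = F z) :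
    IsMeroContinuation F (meroContinuation F) ∧
      ∀ z, AnalyticAt ℂ G z → meroContinuation F =ᶠ[𝓝 z] G := by
  have h : IsMeroContinuation F (toMeromorphicNFOn G univ) :=
    ⟨meromorphicNFOn_toMeromorphicNFOn G univ, σ, fun z hz =>
      (toMeromorphicNFOn_eventuallyEq hG (ha z hz)).eq_of_nhds.trans (hFG z hz)⟩
  rw [h.meroContinuation_eq]
  exact ⟨h, fun z hz => toMeromorphicNFOn_eventuallyEq hG hz⟩

/-- Identity theorem on the complement of a finite set. -/
theorem eq_of_analyticAt_of_eq_halfPlane {F G : ℂ → ℂ} {S : Set ℂ} (hS : S.Finite) (σ : ℝ)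
    (hF : ∀ z, z ∉ S → AnalyticAt ℂ F z) (hG : ∀ z, z ∉ S → AnalyticAt ℂ G z)
    (hFG : ∀ z : ℂ, σ < z.re → F z = G z) {z : ℂ} (hz : z ∉ S) : F z = G z := by
  have hconn : IsPreconnected Sᶜ :=
    (hS.countable.isConnected_compl_of_one_lt_rank (by simp)).isPreconnected
  have hopen : IsOpen {z : ℂ | σ < z.re} := isOpen_lt continuous_const Complex.continuous_re
  obtain ⟨z₀, hz₀, hz₀S⟩ : ∃ z₀ : ℂ, σ < z₀.re ∧ z₀ ∉ S := by
    obtain ⟨M, hM⟩ := (hS.image Complex.re).bddAbove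
    refine ⟨((max σ M + 1 : ℝ) : ℂ), ?_, fun h => ?_⟩
    · rw [Complex.ofReal_re]; linarith [le_max_left σ M]
    · have := hM (mem_image_of_mem _ h)
      rw [Complex.ofReal_re] at this
      linarith [le_max_right σ M]
  have hev : ∀ᶠ z in 𝓝[≠] z₀, F z = G z :=
    nhdsWithin_le_nhds (mem_of_superset (hopen.mem_nhds hz₀) hFG)
  exact AnalyticOnNhd.eqOn_of_preconnected_of_frequently_eq (f := F) (g := G)
    (fun z hz => hF z hz) (fun z hz => hG z hz) hconn hz₀S hev.frequently hz

/-! ### Laplace–Mellin integrals -/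

/-- The Mellin transform at `w` of `t ↦ e^{-yt} R(t)`. -/
def lapMellin (R : ℝ → ℂ) (w y : ℂ) : ℂ :=
  mellin (fun t : ℝ => Complex.exp (-(y * t)) * R t) w

section LapMellin

variable {R : ℝ → ℂ} {n : ℤ} {C : ℝ} {w y : ℂ}

theorem norm_cexp_neg_mul (y : ℂ) (t : ℝ) :
    ‖Complex.exp (-(y * t))‖ = Real.exp (-(y.re * t)) := by
  rw [Complex.norm_exp]; simp

theorem locallyIntegrableOn_exp_mul (hR : ContinuousOn R (Ioi 0)) (y : ℂ) :
    LocallyIntegrableOn (fun t : ℝ => Complex.exp (-(y * t)) * R t) (Ioi 0) :=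
  ContinuousOn.locallyIntegrableOn (ContinuousOn.mul (by fun_prop) hR) measurableSet_Ioi

theorem isBigO_atTop_exp_mul (hb : ∀ t : ℝ, 0 < t → ‖R t‖ ≤ C * t ^ n) (hy : 0 < y.re) :
    (fun t : ℝ => Complex.exp (-(y * t)) * R t) =O[atTop]
      fun t => Real.exp (-(y.re / 2) * t) := by
  have h1 : (fun t : ℝ => Complex.exp (-(y * t)) * R t) =O[atTop]
      fun t => Real.exp (-(y.re * t)) * t ^ n := by
    refine Asymptotics.IsBigO.of_bound C ?_
    filter_upwards [eventually_gt_atTop 0] with t ht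
    have := hb t ht
    rw [norm_mul, norm_cexp_neg_mul, Real.norm_of_nonneg (by positivity)]
    nlinarith [Real.exp_pos (-(y.re * t))]
  have h2 : (fun t : ℝ => t ^ n) =O[atTop] fun t => Real.exp (y.re / 2 * t) :=
    (isLittleO_zpow_exp_pos_mul_atTop n (by positivity)).isBigO
  refine (h1.trans ((Asymptotics.isBigO_refl _ _).mul h2)).trans
    (Asymptotics.isBigO_of_le _ fun t => le_of_eq ?_)
  rw [← Real.exp_add]
  congr 2; ring

theorem isBigO_zero_exp_mul (hb : ∀ t : ℝ, 0 < t → ‖R t‖ ≤ C * t ^ n) (hy : 0 < y.re) :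
    (fun t : ℝ => Complex.exp (-(y * t)) * R t) =O[𝓝[>] 0] fun t => t ^ (-(-n : ℝ)) := by
  refine Asymptotics.IsBigO.of_bound C ?_
  filter_upwards [self_mem_nhdsWithin] with t (ht : 0 < t)
  have h0 := hb t ht
  have h2 : Real.exp (-(y.re * t)) ≤ 1 := Real.exp_le_one_iff.2 (by nlinarith)
  rw [neg_neg, Real.rpow_intCast, norm_mul, norm_cexp_neg_mul, Real.norm_of_nonneg (by positivity)]
  nlinarith [norm_nonneg (R t)]

theorem mellinConvergent_exp_mul (hR : ContinuousOn R (Ioi 0))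
    (hb : ∀ t : ℝ, 0 < t → ‖R t‖ ≤ C * t ^ n) (hw : -(n : ℝ) < w.re) (hy : 0 < y.re) :
    MellinConvergent (fun t : ℝ => Complex.exp (-(y * t)) * R t) w :=
  mellinConvergent_of_isBigO_rpow_exp (by positivity) (locallyIntegrableOn_exp_mul hR y)
    (isBigO_atTop_exp_mul hb hy) (isBigO_zero_exp_mul hb hy) hw

theorem differentiableAt_lapMellin_left (hR : ContinuousOn R (Ioi 0))
    (hb : ∀ t : ℝ, 0 < t → ‖R t‖ ≤ C * t ^ n) (hw : -(n : ℝ) < w.re) (hy : 0 < y.re) :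
    DifferentiableAt ℂ (fun w => lapMellin R w y) w :=
  mellin_differentiableAt_of_isBigO_rpow_exp (by positivity) (locallyIntegrableOn_exp_mul hR y)
    (isBigO_atTop_exp_mul hb hy) (isBigO_zero_exp_mul hb hy) hw

theorem differentiableAt_lapMellin_right (hR : ContinuousOn R (Ioi 0))
    (hb : ∀ t : ℝ, 0 < t → ‖R t‖ ≤ C * t ^ n) (hw : -(n : ℝ) < w.re) (hy : 0 < y.re) :
    DifferentiableAt ℂ (fun y => lapMellin R w y) y := by
  have hmeas : ∀ g : ℝ → ℂ, Continuous g →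
      AEStronglyMeasurable (fun t : ℝ => (t : ℂ) ^ (w - 1) • (g t * R t))
        (volume.restrict (Ioi 0)) := by
    intro g hg
    refine ContinuousOn.aestronglyMeasurable ?_ measurableSet_Ioi
    simp only [smul_eq_mul]
    refine ContinuousOn.mul (fun t ht => ?_) (hg.continuousOn.mul hR)
    exact (Complex.continuousAt_ofReal_cpow_const _ _ (Or.inr (ne_of_gt ht))).continuousWithinAt
  have hbound : IntegrableOn (fun t : ℝ => C * (t ^ (w.re + n) * Real.exp (-(y.re / 2) * t)))
      (Ioi 0) := by
    have := integrableOn_rpow_mul_exp_neg_mul_rpow (s := w.re + n) (p := 1) (b := y.re / 2)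
      (by linarith) one_pos (by positivity)
    simp only [Real.rpow_one] at this
    exact this.const_mul C
  have key := hasDerivAt_integral_of_dominated_loc_of_deriv_le
    (μ := volume.restrict (Ioi (0 : ℝ))) (𝕜 := ℂ)
    (F := fun (y : ℂ) (t : ℝ) => (t : ℂ) ^ (w - 1) • (Complex.exp (-(y * t)) * R t))
    (F' := fun (y : ℂ) (t : ℝ) => (t : ℂ) ^ (w - 1) • ((-t * Complex.exp (-(y * t))) * R t))
    (bound := fun t : ℝ => C * (t ^ (w.re + n) * Real.exp (-(y.re / 2) * t)))
    (x₀ := y) (s := {z : ℂ | y.re / 2 < z.re})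
    ((isOpen_lt continuous_const Complex.continuous_re).mem_nhds (by simp; linarith))
    (Eventually.of_forall fun z => hmeas (fun t : ℝ => Complex.exp (-(z * t))) (by fun_prop))
    (mellinConvergent_exp_mul hR hb hw hy)
    (hmeas (fun t : ℝ => -t * Complex.exp (-(y * t))) (by fun_prop)) ?_ hbound ?_
  · exact key.2.differentiableAt
  · filter_upwards [ae_restrict_mem measurableSet_Ioi] with t (ht : 0 < t) z (hz : y.re / 2 < z.re)
    have h0 := hb t ht
    have h1 : Real.exp (-(z.re * t)) ≤ Real.exp (-(y.re / 2) * t) :=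
      Real.exp_le_exp.2 (by nlinarith)
    have h2 : t ^ (w.re + n) = t ^ (w.re - 1) * (t * t ^ n) := by
      rw [show w.re + n = (w.re - 1) + 1 + n by ring, Real.rpow_add ht, Real.rpow_add ht,
        Real.rpow_one, Real.rpow_intCast, mul_assoc]
    rw [norm_smul, norm_mul, norm_mul, norm_cexp_neg_mul, norm_neg, Complex.norm_real,
      Real.norm_of_nonneg ht.le, Complex.norm_cpow_eq_rpow_re_of_pos ht, Complex.sub_re,
      Complex.one_re, h2]
    calc t ^ (w.re - 1) * (t * Real.exp (-(z.re * t)) * ‖R t‖)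
        ≤ t ^ (w.re - 1) * (t * Real.exp (-(y.re / 2) * t) * (C * t ^ n)) := by gcongr
      _ = _ := by ring
  · filter_upwards [ae_restrict_mem measurableSet_Ioi] with t (ht : 0 < t) z _
    simp only [smul_eq_mul]
    refine HasDerivAt.const_mul _ (HasDerivAt.mul_const ?_ _)
    have : HasDerivAt (fun z : ℂ => -(z * t)) (-t : ℂ) z := by
      simpa using ((hasDerivAt_id z).mul_const (t : ℂ)).fun_neg
    simpa [mul_comm] using this.cexp

theorem lapMellin_one_ofReal {w : ℂ} (hw : 0 < w.re) {y : ℝ} (hy : 0 < y) :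
    lapMellin (fun _ => 1) w y = (y : ℂ) ^ (-w) * Complex.Gamma w := by
  have h := Complex.integral_cpow_mul_exp_neg_mul_Ioi hw hy
  rw [one_div, Complex.inv_cpow _ _ (by rw [Complex.arg_ofReal_of_nonneg hy.le]; positivity),
    ← Complex.cpow_neg] at h
  simpa [lapMellin, mellin] using h

/-- The Laplace–Mellin integral of a constant; Mathlib has the case of real `y`, from which the
general case follows by the identity theorem. -/
theorem lapMellin_one {w : ℂ} (hw : 0 < w.re) {y : ℂ} (hy : 0 < y.re) :
    lapMellin (fun _ => 1) w y = y ^ (-w) * Complex.Gamma w := by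
  have hopen : IsOpen {y : ℂ | 0 < y.re} := isOpen_lt continuous_const Complex.continuous_re
  have hF : AnalyticOnNhd ℂ (fun y => lapMellin (fun _ => 1) w y) {y : ℂ | 0 < y.re} := by
    refine DifferentiableOn.analyticOnNhd (fun y hy => ?_) hopen
    exact (differentiableAt_lapMellin_right (n := 0) (C := 1) continuousOn_const (by simp)
      (by simpa using hw) hy).differentiableWithinAt
  have hG : AnalyticOnNhd ℂ (fun y => y ^ (-w) * Complex.Gamma w) {y : ℂ | 0 < y.re} := by
    refine DifferentiableOn.analyticOnNhd (fun y hy => ?_) hopen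
    exact ((differentiableAt_id.cpow_const (Or.inl hy)).mul_const _).differentiableWithinAt
  refine hF.eqOn_of_preconnected_of_frequently_eq hG
    (convex_halfSpace_re_gt 0).isPreconnected (z₀ := 1) (by simp) ?_ hy
  have hseq : Tendsto (fun k : ℕ => ((1 + 1 / ((k : ℝ) + 1) : ℝ) : ℂ)) atTop (𝓝[≠] 1) := by
    refine tendsto_nhdsWithin_iff.2 ⟨?_, Eventually.of_forall fun k => ?_⟩
    · have := (tendsto_one_div_add_atTop_nhds_zero_nat (𝕜 := ℝ)).const_add 1
      rw [add_zero] at this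
      simpa [Function.comp_def] using (Complex.continuous_ofReal.tendsto 1).comp this
    · have : (0 : ℝ) < 1 / ((k : ℝ) + 1) := by positivity
      intro h
      have h' : (1 + 1 / ((k : ℝ) + 1) : ℝ) = 1 := by exact_mod_cast mem_singleton_iff.1 h
      linarith
  exact hseq.frequently (Eventually.frequently (Eventually.of_forall fun k =>
    lapMellin_one_ofReal hw (by positivity)))

theorem lapMellin_zpow (k : ℤ) {w : ℂ} (hw : 0 < (w + k).re) {y : ℂ} (hy : 0 < y.re) :
    lapMellin (fun t => (t : ℂ) ^ k) w y = y ^ (-(w + k)) * Complex.Gamma (w + k) := by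
  rw [← lapMellin_one hw hy]
  refine setIntegral_congr_fun measurableSet_Ioi fun t (ht : 0 < t) => ?_
  have : (t : ℂ) ≠ 0 := by exact_mod_cast ht.ne'
  simp only [smul_eq_mul]
  rw [show w + k - 1 = (w - 1) + k by ring, Complex.cpow_add _ _ this, Complex.cpow_intCast]
  ring

end LapMellin

/-! ### The quotients `Γ(w + k - c) / Γ(w)` -/

/-- The rational function of `w` that equals `Γ(w + k - c) / Γ(w)`. At least one of the two
products is empty. -/
def gammaQuot (c k : ℕ) (w : ℂ) : ℂ :=
  (∏ i ∈ Finset.range (k - c), (w + i)) * ∏ i ∈ Finset.range (c - k), (w - (i + 1))⁻¹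

theorem Gamma_inv_eq_prod (j : ℕ) (w : ℂ) :
    (Complex.Gamma w)⁻¹ = (∏ i ∈ Finset.range j, (w + i)) * (Complex.Gamma (w + j))⁻¹ := by
  induction j with
  | zero => simp
  | succ j ih =>
    rw [ih, Finset.prod_range_succ, Complex.one_div_Gamma_eq_self_mul_one_div_Gamma_add_one (w + j)]
    push_cast
    ring_nf

theorem Gamma_inv_mul_Gamma (c k : ℕ) {w : ℂ} (hw : 0 < (w + ((k : ℤ) - c : ℤ)).re) :
    (Complex.Gamma w)⁻¹ * Complex.Gamma (w + ((k : ℤ) - c : ℤ)) = gammaQuot c k w := by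
  have hne := Complex.Gamma_ne_zero_of_re_pos hw
  rcases le_total c k with h | h
  · obtain ⟨j, rfl⟩ := Nat.exists_eq_add_of_le h
    have e : w + (((c + j : ℕ) : ℤ) - c : ℤ) = w + j := by push_cast; ring
    rw [e] at hne ⊢
    rw [Gamma_inv_eq_prod j w, mul_assoc, inv_mul_cancel₀ hne]
    simp [gammaQuot]
  · obtain ⟨j, rfl⟩ := Nat.exists_eq_add_of_le h
    have e : w + ((k : ℤ) - ((k + j : ℕ) : ℤ) : ℤ) = w - j := by push_cast; ring
    rw [e] at hne hw ⊢
    have h1 := Gamma_inv_eq_prod j (w - j)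
    rw [sub_add_cancel] at h1
    have h2 : ∏ i ∈ Finset.range j, (w - j + i) = ∏ i ∈ Finset.range j, (w - (i + 1)) := by
      rw [← Finset.prod_range_reflect]
      refine Finset.prod_congr rfl fun i hi => ?_
      have : i + 1 ≤ j := Finset.mem_range.1 hi
      rw [show j - 1 - i = j - (i + 1) by omega]
      push_cast [this]
      ring
    have h3 : (∏ i ∈ Finset.range j, (w - (i + 1))) ≠ 0 := by
      intro h0
      rw [h2, h0, zero_mul] at h1
      exact inv_ne_zero hne h1
    rw [h2] at h1
    have h4 : (Complex.Gamma w)⁻¹ = (∏ i ∈ Finset.range j, (w - (i + 1)))⁻¹ *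
        (Complex.Gamma (w - j))⁻¹ := by rw [h1]; field_simp
    rw [h4, mul_assoc, inv_mul_cancel₀ hne]
    simp [gammaQuot, Finset.prod_inv_distrib]

/-- The poles of `Γ(w + k - c) / Γ(w)` lie in `{1, …, c}`. -/
theorem analyticAt_gammaQuot (c k : ℕ) {w : ℂ} (hw : ∀ j ∈ Finset.Icc 1 c, w ≠ (j : ℂ)) :
    AnalyticAt ℂ (gammaQuot c k) w := by
  refine (Finset.analyticAt_fun_prod _ fun i _ => by fun_prop).mul
    (Finset.analyticAt_fun_prod _ fun i hi => ?_)
  refine AnalyticAt.fun_inv (by fun_prop) ?_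
  have := hw (i + 1) (by simp at hi ⊢; omega)
  rw [sub_ne_zero]
  exact_mod_cast this

theorem meromorphicAt_gammaQuot (c k : ℕ) (w : ℂ) : MeromorphicAt (gammaQuot c k) w := by
  refine MeromorphicAt.mul (Finset.analyticAt_fun_prod _ fun i _ => by fun_prop).meromorphicAt
    (MeromorphicAt.fun_prod fun i _ => ?_)
  exact MeromorphicAt.fun_inv (by fun_prop)

theorem ne_natCast_of_lt_re {c : ℕ} {w : ℂ} (hw : (c : ℝ) < w.re) :
    ∀ j ∈ Finset.Icc 1 c, w ≠ (j : ℂ) := by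
  rintro j hj rfl
  have h1 : (j : ℝ) ≤ c := by exact_mod_cast (Finset.mem_Icc.1 hj).2
  rw [Complex.natCast_re] at hw
  linarith

theorem ne_natCast_mono {w : ℂ} {c d : ℕ} (hcd : c ≤ d) (hw : ∀ j ∈ Finset.Icc 1 d, w ≠ (j : ℂ)) :
    ∀ j ∈ Finset.Icc 1 c, w ≠ (j : ℂ) := fun j hj =>
  hw j (Finset.mem_Icc.2 ⟨(Finset.mem_Icc.1 hj).1, (Finset.mem_Icc.1 hj).2.trans hcd⟩)

theorem zero_ne_natCast (c : ℕ) : ∀ j ∈ Finset.Icc 1 c, (0 : ℂ) ≠ (j : ℂ) := fun j hj => by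
  have := (Finset.mem_Icc.1 hj).1
  exact_mod_cast (show (0 : ℕ) ≠ j by omega)

theorem ne_zero_of_re_pos {y : ℂ} (hy : 0 < y.re) : y ≠ 0 := by
  rintro rfl; simp at hy

theorem analyticAt_cpow_neg_add {y : ℂ} (hy : y ≠ 0) (k : ℤ) (w : ℂ) :
    AnalyticAt ℂ (fun w : ℂ => y ^ (-(w + k))) w := by
  simp only [Complex.cpow_def_of_ne_zero hy]
  fun_prop

theorem analyticAt_cpow_neg {z : ℂ} (hz : z ≠ 0) (w : ℂ) :
    AnalyticAt ℂ (fun w : ℂ => z ^ (-w)) w := by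
  simp only [Complex.cpow_def_of_ne_zero hz]
  fun_prop

theorem hasDerivAt_Gamma_inv_zero : HasDerivAt (fun w => (Complex.Gamma w)⁻¹) 1 0 := by
  have h1 : HasDerivAt (fun w : ℂ => w * (Complex.Gamma (w + 1))⁻¹)
      (1 * (Complex.Gamma (0 + 1))⁻¹ +
        0 * deriv (fun w : ℂ => (Complex.Gamma (w + 1))⁻¹) 0) 0 :=
    (hasDerivAt_id (0 : ℂ)).mul
      (Complex.differentiable_one_div_Gamma.comp (differentiable_id.add_const (1 : ℂ))
        (0 : ℂ)).hasDerivAt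
  simp only [zero_add, Complex.Gamma_one, inv_one, mul_one, zero_mul, add_zero] at h1
  exact h1.congr_of_eventuallyEq (Eventually.of_forall fun w =>
    Complex.one_div_Gamma_eq_self_mul_one_div_Gamma_add_one w)

/-! ### Continuation of Laplace–Mellin integrals -/

/-- The remainder of order `n` of a Laurent expansion `∑ a_k t^{k - c}` of `Q` at `0`. -/
def laurentRem (Q : ℝ → ℂ) (c : ℕ) (a : ℕ → ℂ) (n : ℕ) (t : ℝ) : ℂ :=
  Q t - ∑ k ∈ Finset.range (c + n), a k * (t : ℂ) ^ ((k : ℤ) - c)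

/-- `Q` has the Laurent expansion `∑ a_k t^{k - c}` at `0`, with all remainders controlled on the
whole half-line: the `n`-th one is `O(t ^ n)` uniformly in `t > 0`. For bounded `Q` near infinity
this follows from the behaviour near `0`. -/
structure HasLaurentBound (Q : ℝ → ℂ) (c : ℕ) (a : ℕ → ℂ) : Prop where
  continuousOn : ContinuousOn Q (Ioi 0)
  bound : ∀ n : ℕ, ∃ C : ℝ, ∀ t : ℝ, 0 < t → ‖laurentRem Q c a n t‖ ≤ C * t ^ (n : ℤ)

/-- The continuation of `Γ(w)⁻¹ ∫ e^{-yt} Q(t) t^{w-1} dt` to `Re w > -n`, obtained by integrating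
the first `c + n` terms of the Laurent expansion of `Q` explicitly. -/
def lapExt (Q : ℝ → ℂ) (c : ℕ) (a : ℕ → ℂ) (n : ℕ) (w y : ℂ) : ℂ :=
  ∑ k ∈ Finset.range (c + n), a k * (gammaQuot c k w * y ^ (-(w + ((k : ℤ) - c : ℤ)))) +
    (Complex.Gamma w)⁻¹ * lapMellin (laurentRem Q c a n) w y

/-- The continuation of `Γ(w)⁻¹ ∫ e^{-yt} Q(t) t^{w-1} dt` to all `w`: the number of subtracted
terms is chosen large enough for the given `w`. -/
def lapCont (Q : ℝ → ℂ) (c : ℕ) (a : ℕ → ℂ) (w y : ℂ) : ℂ :=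
  lapExt Q c a (⌈‖w‖⌉₊ + 1) w y

theorem lapMellin_sum_add {ι : Type*} (s : Finset ι) (a : ι → ℂ) {f : ι → ℝ → ℂ} {g : ℝ → ℂ}
    {w y : ℂ}
    (hf : ∀ i ∈ s, MellinConvergent (fun t : ℝ => Complex.exp (-(y * t)) * f i t) w)
    (hg : MellinConvergent (fun t : ℝ => Complex.exp (-(y * t)) * g t) w) :
    MellinConvergent (fun t : ℝ => Complex.exp (-(y * t)) * (∑ i ∈ s, a i * f i t + g t)) w ∧
    lapMellin (fun t => ∑ i ∈ s, a i * f i t + g t) w y =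
      ∑ i ∈ s, a i * lapMellin (f i) w y + lapMellin g w y := by
  have e : (fun t : ℝ => (t : ℂ) ^ (w - 1) •
        (Complex.exp (-(y * t)) * (∑ i ∈ s, a i * f i t + g t))) =
      fun t : ℝ => (∑ i ∈ s, a i * ((t : ℂ) ^ (w - 1) • (Complex.exp (-(y * t)) * f i t))) +
        (t : ℂ) ^ (w - 1) • (Complex.exp (-(y * t)) * g t) := by
    funext t
    simp only [smul_eq_mul, mul_add, Finset.mul_sum]
    congr 1
    exact Finset.sum_congr rfl fun i _ => by ring
  have hs : ∀ i ∈ s, Integrable (fun t : ℝ =>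
      a i * ((t : ℂ) ^ (w - 1) • (Complex.exp (-(y * t)) * f i t)))
      (volume.restrict (Ioi 0)) := fun i hi => (hf i hi).const_mul _
  constructor
  · rw [MellinConvergent, e]
    exact (integrable_finsetSum _ hs).add hg
  · rw [lapMellin, mellin, e, integral_add (integrable_finsetSum _ hs) hg,
      integral_finsetSum _ hs]
    simp only [integral_const_mul]
    rfl

theorem continuousOn_zpow_ofReal (k : ℤ) : ContinuousOn (fun t : ℝ => (t : ℂ) ^ k) (Ioi 0) :=
  fun t ht => (ContinuousAt.zpow₀ (by fun_prop) k
    (Or.inl (by exact_mod_cast (ne_of_gt ht)))).continuousWithinAt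

theorem norm_zpow_ofReal_le (k : ℤ) (t : ℝ) (ht : 0 < t) : ‖(t : ℂ) ^ k‖ ≤ 1 * t ^ k := by
  rw [norm_zpow, Complex.norm_real, Real.norm_of_nonneg ht.le, one_mul]

theorem mellinConvergent_zpow (k : ℤ) {w y : ℂ} (hw : 0 < (w + k).re) (hy : 0 < y.re) :
    MellinConvergent (fun t : ℝ => Complex.exp (-(y * t)) * (t : ℂ) ^ k) w :=
  mellinConvergent_exp_mul (n := k) (continuousOn_zpow_ofReal k) (norm_zpow_ofReal_le k)
    (by simp at hw; linarith) hy

namespace HasLaurentBound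

variable {Q : ℝ → ℂ} {c : ℕ} {a : ℕ → ℂ}

theorem continuousOn_rem (h : HasLaurentBound Q c a) (n : ℕ) :
    ContinuousOn (laurentRem Q c a n) (Ioi 0) :=
  h.continuousOn.sub (continuousOn_finsetSum _ fun _ _ =>
    continuousOn_const.mul (continuousOn_zpow_ofReal _))

theorem mellinConvergent_rem (h : HasLaurentBound Q c a) (n : ℕ) {w y : ℂ}
    (hw : -(n : ℝ) < w.re) (hy : 0 < y.re) :
    MellinConvergent (fun t : ℝ => Complex.exp (-(y * t)) * laurentRem Q c a n t) w := by
  obtain ⟨C, hC⟩ := h.bound n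
  exact mellinConvergent_exp_mul (h.continuousOn_rem n) hC (by simpa using hw) hy

/-- In the half-plane of convergence `Re w > c` all Laurent terms and the remainder can be
integrated separately. -/
theorem mellinConvergent_and_eq (h : HasLaurentBound Q c a) (n : ℕ) {w y : ℂ}
    (hw : (c : ℝ) < w.re) (hy : 0 < y.re) :
    MellinConvergent (fun t : ℝ => Complex.exp (-(y * t)) * Q t) w ∧
      (Complex.Gamma w)⁻¹ * lapMellin Q w y = lapExt Q c a n w y := by
  have hpos : ∀ k : ℕ, 0 < (w + ((k : ℤ) - c : ℤ)).re := by
    intro k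
    have : (0 : ℝ) ≤ k := k.cast_nonneg
    simp; linarith
  have e : Q = fun t : ℝ => ∑ k ∈ Finset.range (c + n), a k * (t : ℂ) ^ ((k : ℤ) - c) +
      laurentRem Q c a n t := by
    funext t; simp [laurentRem]
  have hw' : -(n : ℝ) < w.re := by
    have h1 : (0 : ℝ) ≤ n := n.cast_nonneg
    have h2 : (0 : ℝ) ≤ c := c.cast_nonneg
    linarith
  have key := lapMellin_sum_add (Finset.range (c + n)) a
    (f := fun k (t : ℝ) => (t : ℂ) ^ ((k : ℤ) - c)) (w := w) (y := y)
    (fun k _ => mellinConvergent_zpow _ (hpos k) hy) (h.mellinConvergent_rem n hw' hy)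
  rw [← e] at key
  have e2 : (fun t : ℝ => Complex.exp (-(y * t)) * Q t) = fun t : ℝ => Complex.exp (-(y * t)) *
      (∑ k ∈ Finset.range (c + n), a k * (t : ℂ) ^ ((k : ℤ) - c) + laurentRem Q c a n t) := by
    funext t; congr 1; exact congrFun e t
  rw [← e2] at key
  refine ⟨key.1, ?_⟩
  rw [key.2, lapExt, mul_add, Finset.mul_sum]
  congr 1
  refine Finset.sum_congr rfl fun k _ => ?_
  rw [lapMellin_zpow _ (hpos k) hy, ← Gamma_inv_mul_Gamma c k (hpos k)]
  ring

/-- The next Laurent term may be integrated explicitly, since `w` is in the half-plane where its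
integral converges. -/
theorem lapExt_succ (h : HasLaurentBound Q c a) (n : ℕ) {w y : ℂ}
    (hw : -(n : ℝ) < w.re) (hy : 0 < y.re) :
    lapExt Q c a n w y = lapExt Q c a (n + 1) w y := by
  have e : laurentRem Q c a n = fun t : ℝ => ∑ k ∈ {c + n}, a k * (t : ℂ) ^ ((k : ℤ) - c) +
      laurentRem Q c a (n + 1) t := by
    funext t
    simp only [laurentRem, Finset.sum_singleton, ← add_assoc, Finset.sum_range_succ]
    ring
  have hpos : 0 < (w + (((c + n : ℕ) : ℤ) - c : ℤ)).re := by simp; linarith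
  have key := lapMellin_sum_add {c + n} a
    (f := fun k (t : ℝ) => (t : ℂ) ^ ((k : ℤ) - c)) (w := w) (y := y)
    (fun k hk => by
      rw [Finset.mem_singleton.1 hk]; exact mellinConvergent_zpow _ hpos hy)
    (h.mellinConvergent_rem (n + 1) (by push_cast; linarith) hy)
  rw [lapExt, e, key.2, lapExt, ← add_assoc c n 1, Finset.sum_range_succ, Finset.sum_singleton,
    lapMellin_zpow _ hpos hy, ← Gamma_inv_mul_Gamma c (c + n) hpos]
  ring

theorem lapExt_eq_of_le (h : HasLaurentBound Q c a) {n m : ℕ} (hnm : n ≤ m) {w y : ℂ}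
    (hw : -(n : ℝ) < w.re) (hy : 0 < y.re) : lapExt Q c a n w y = lapExt Q c a m w y := by
  induction m, hnm using Nat.le_induction with
  | base => rfl
  | succ m hm ih =>
    rw [ih]
    refine h.lapExt_succ m ?_ hy
    have : (n : ℝ) ≤ m := by exact_mod_cast hm
    linarith

/-- On `Re w > -n`, subtracting `c + n` terms is enough to obtain the continuation. -/
theorem lapCont_eq (h : HasLaurentBound Q c a) (n : ℕ) {w y : ℂ}
    (hw : -(n : ℝ) < w.re) (hy : 0 < y.re) : lapCont Q c a w y = lapExt Q c a n w y := by
  have hw' : -((⌈‖w‖⌉₊ + 1 : ℕ) : ℝ) < w.re := by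
    have h1 := Complex.abs_re_le_norm w
    have h2 := Nat.le_ceil ‖w‖
    have h3 := neg_abs_le w.re
    push_cast; linarith
  rcases le_total n (⌈‖w‖⌉₊ + 1) with hle | hle
  · exact (h.lapExt_eq_of_le hle hw hy).symm
  · exact h.lapExt_eq_of_le hle hw' hy

theorem lapCont_eq_mellin (h : HasLaurentBound Q c a) {w y : ℂ} (hw : (c : ℝ) < w.re)
    (hy : 0 < y.re) : lapCont Q c a w y = (Complex.Gamma w)⁻¹ * lapMellin Q w y := by
  have : (0 : ℝ) ≤ c := c.cast_nonneg
  rw [h.lapCont_eq 0 (by simp; linarith) hy, ← (h.mellinConvergent_and_eq 0 hw hy).2]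

theorem analyticAt_rem (h : HasLaurentBound Q c a) (n : ℕ) {w y : ℂ}
    (hw : -(n : ℝ) < w.re) (hy : 0 < y.re) :
    AnalyticAt ℂ (fun w => (Complex.Gamma w)⁻¹ * lapMellin (laurentRem Q c a n) w y) w := by
  obtain ⟨C, hC⟩ := h.bound n
  have hopen : IsOpen {w : ℂ | -(n : ℝ) < w.re} :=
    isOpen_lt continuous_const Complex.continuous_re
  have hd : DifferentiableOn ℂ (fun w => lapMellin (laurentRem Q c a n) w y)
      {w : ℂ | -(n : ℝ) < w.re} := fun z hz =>
    (differentiableAt_lapMellin_left (h.continuousOn_rem n) hC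
      (by simpa using hz) hy).differentiableWithinAt
  exact (Complex.differentiable_one_div_Gamma.analyticAt w).fun_mul
    (hd.analyticAt (hopen.mem_nhds hw))

theorem lapCont_eventuallyEq (h : HasLaurentBound Q c a) (w : ℂ) {y : ℂ} (hy : 0 < y.re) :
    ∃ n : ℕ, -(n : ℝ) < w.re ∧
      (fun w => lapCont Q c a w y) =ᶠ[𝓝 w] fun w => lapExt Q c a n w y := by
  obtain ⟨n, hn⟩ := exists_nat_gt (-w.re)
  have hopen : IsOpen {w : ℂ | -(n : ℝ) < w.re} :=
    isOpen_lt continuous_const Complex.continuous_re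
  have hw : -(n : ℝ) < w.re := by linarith
  exact ⟨n, hw, mem_of_superset (hopen.mem_nhds hw) fun z hz => h.lapCont_eq n hz hy⟩

theorem analyticAt_lapCont (h : HasLaurentBound Q c a) {w y : ℂ} (hy : 0 < y.re)
    (hw : ∀ j ∈ Finset.Icc 1 c, w ≠ (j : ℂ)) : AnalyticAt ℂ (fun w => lapCont Q c a w y) w := by
  obtain ⟨n, hn, he⟩ := h.lapCont_eventuallyEq w hy
  refine AnalyticAt.congr ?_ he.symm
  refine AnalyticAt.fun_add (Finset.analyticAt_fun_sum _ fun k _ => ?_) (h.analyticAt_rem n hn hy)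
  exact analyticAt_const.fun_mul ((analyticAt_gammaQuot c k hw).fun_mul
    (analyticAt_cpow_neg_add (ne_zero_of_re_pos hy) _ _))

theorem meromorphicAt_lapCont (h : HasLaurentBound Q c a) (w : ℂ) {y : ℂ} (hy : 0 < y.re) :
    MeromorphicAt (fun w => lapCont Q c a w y) w := by
  obtain ⟨n, hn, he⟩ := h.lapCont_eventuallyEq w hy
  refine MeromorphicAt.congr ?_ (he.symm.filter_mono nhdsWithin_le_nhds)
  refine MeromorphicAt.fun_add (MeromorphicAt.fun_sum fun k _ => ?_)
    (h.analyticAt_rem n hn hy).meromorphicAt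
  exact (MeromorphicAt.const _ _).fun_mul ((meromorphicAt_gammaQuot c k w).fun_mul
    (analyticAt_cpow_neg_add (ne_zero_of_re_pos hy) _ _).meromorphicAt)

theorem differentiableAt_lapCont_right (h : HasLaurentBound Q c a) (w : ℂ) {y : ℂ}
    (hy : 0 < y.re) : DifferentiableAt ℂ (fun y => lapCont Q c a w y) y := by
  obtain ⟨n, hn⟩ := exists_nat_gt (-w.re)
  have hw : -(n : ℝ) < w.re := by linarith
  have hopen : IsOpen {y : ℂ | 0 < y.re} := isOpen_lt continuous_const Complex.continuous_re
  have he : (fun y => lapCont Q c a w y) =ᶠ[𝓝 y] fun y => lapExt Q c a n w y :=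
    mem_of_superset (hopen.mem_nhds hy) fun z hz => h.lapCont_eq n hw hz
  refine DifferentiableAt.congr_of_eventuallyEq ?_ he
  obtain ⟨C, hC⟩ := h.bound n
  refine DifferentiableAt.fun_add (DifferentiableAt.fun_sum fun k _ => ?_)
    ((differentiableAt_lapMellin_right (h.continuousOn_rem n) hC
      (by simpa using hw) hy).const_mul _)
  exact ((differentiableAt_id.cpow_const (Or.inl hy)).const_mul _).const_mul _

end HasLaurentBound

/-- The derivative at `w = 0` of the continuation of `Γ(w)⁻¹ ∫ e^{-yt} Q(t) t^{w-1} dt`. Since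
`1 / Γ` has a simple zero at `0`, the remainder contributes its Mellin transform at `0` itself. -/
def lapDeriv (Q : ℝ → ℂ) (c : ℕ) (a : ℕ → ℂ) (y : ℂ) : ℂ :=
  ∑ k ∈ Finset.range (c + 1), a k * (deriv (gammaQuot c k) 0 * y ^ (-((k : ℤ) - c : ℤ) : ℂ) +
    gammaQuot c k 0 * (y ^ (-((k : ℤ) - c : ℤ) : ℂ) * Complex.log y * -1)) +
    lapMellin (laurentRem Q c a 1) 0 y

namespace HasLaurentBound

variable {Q : ℝ → ℂ} {c : ℕ} {a : ℕ → ℂ}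

theorem hasDerivAt_lapCont_zero (h : HasLaurentBound Q c a) {y : ℂ} (hy : 0 < y.re) :
    HasDerivAt (fun w => lapCont Q c a w y) (lapDeriv Q c a y) 0 := by
  have hopen : IsOpen {w : ℂ | -((1 : ℕ) : ℝ) < w.re} :=
    isOpen_lt continuous_const Complex.continuous_re
  have he : (fun w => lapCont Q c a w y) =ᶠ[𝓝 0] fun w => lapExt Q c a 1 w y :=
    mem_of_superset (hopen.mem_nhds (by simp)) fun z hz => h.lapCont_eq 1 hz hy
  refine HasDerivAt.congr_of_eventuallyEq ?_ he
  obtain ⟨C, hC⟩ := h.bound 1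
  refine HasDerivAt.fun_add (HasDerivAt.fun_sum fun k _ => HasDerivAt.const_mul _ ?_) ?_
  · have h1 : HasDerivAt (gammaQuot c k) (deriv (gammaQuot c k) 0) 0 :=
      (analyticAt_gammaQuot c k (zero_ne_natCast c)).differentiableAt.hasDerivAt
    have h2 : HasDerivAt (fun w : ℂ => y ^ (-(w + ((k : ℤ) - c : ℤ))))
        (y ^ (-((k : ℤ) - c : ℤ) : ℂ) * Complex.log y * -1) 0 := by
      have h3 : HasDerivAt (fun w : ℂ => -(w + ((k : ℤ) - c : ℤ))) (-1) 0 :=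
        ((hasDerivAt_id (0 : ℂ)).add_const _).fun_neg
      have := h3.const_cpow (c := y) (Or.inl (ne_zero_of_re_pos hy))
      simpa using this
    have := h1.fun_mul h2
    simpa using this
  · have h1 := hasDerivAt_Gamma_inv_zero.fun_mul (differentiableAt_lapMellin_left (w := 0)
      (h.continuousOn_rem 1) hC (by simp) hy).hasDerivAt
    simpa using h1

theorem differentiableAt_lapDeriv (h : HasLaurentBound Q c a) {y : ℂ} (hy : 0 < y.re) :
    DifferentiableAt ℂ (lapDeriv Q c a) y := by
  obtain ⟨C, hC⟩ := h.bound 1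
  refine DifferentiableAt.fun_add (DifferentiableAt.fun_sum fun k _ => ?_)
    (differentiableAt_lapMellin_right (h.continuousOn_rem 1) hC (by simp) hy)
  have h1 : DifferentiableAt ℂ (fun y : ℂ => y ^ (-((k : ℤ) - c : ℤ) : ℂ)) y :=
    differentiableAt_id.cpow_const (Or.inl hy)
  have h2 : DifferentiableAt ℂ Complex.log y := Complex.differentiableAt_log (Or.inl hy)
  exact ((h1.const_mul _).fun_add (((h1.fun_mul h2).mul_const _).const_mul _)).const_mul _

end HasLaurentBound

/-! ### Laurent expansions of bounded functions -/

theorem sum_zpow_bound (a : ℕ → ℂ) (c n : ℕ) {t : ℝ} (ht : 1 ≤ t) :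
    ‖∑ k ∈ Finset.range (c + n), a k * (t : ℂ) ^ ((k : ℤ) - c)‖ ≤
      (∑ k ∈ Finset.range (c + n), ‖a k‖) * t ^ (n : ℤ) := by
  rw [Finset.sum_mul]
  refine (norm_sum_le _ _).trans (Finset.sum_le_sum fun k hk => ?_)
  have hk' : k < c + n := Finset.mem_range.1 hk
  rw [norm_mul, norm_zpow, Complex.norm_real, Real.norm_of_nonneg (by linarith)]
  gcongr
  omega

/-- A bounded continuous function with a pole of order at most `c` at `0` satisfies
`HasLaurentBound`. The three ranges `t < ε`, `ε ≤ t ≤ 1`, `1 ≤ t` use the Taylor formula,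
compactness and boundedness, respectively. -/
theorem exists_hasLaurentBound {Q : ℝ → ℂ} {c : ℕ} {H : ℂ → ℂ} {B : ℝ}
    (hQ : ContinuousOn Q (Ioi 0)) (hB : ∀ t : ℝ, 1 ≤ t → ‖Q t‖ ≤ B) (hH : AnalyticAt ℂ H 0)
    (hQH : ∀ t : ℝ, 0 < t → H t = (t : ℂ) ^ c * Q t) :
    ∃ a, HasLaurentBound Q c a ∧ (c = 0 → a 0 = H 0) := by
  obtain ⟨p, hp⟩ := hH
  refine ⟨p.coeff, ⟨hQ, fun n => ?_⟩, fun _ => hp.coeff_zero 1⟩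
  have hcont : ContinuousOn (laurentRem Q c p.coeff n) (Ioi 0) :=
    hQ.sub (continuousOn_finsetSum _ fun _ _ =>
      continuousOn_const.mul (continuousOn_zpow_ofReal _))
  have hrem : ∀ t : ℝ, 0 < t → laurentRem Q c p.coeff n t =
      ((t : ℂ) ^ c)⁻¹ * (H t - p.partialSum (c + n) t) := by
    intro t ht
    have ht' : (t : ℂ) ≠ 0 := by exact_mod_cast ht.ne'
    rw [hQH t ht, laurentRem, mul_sub, inv_mul_cancel_left₀ (pow_ne_zero _ ht'),
      FormalMultilinearSeries.partialSum, Finset.mul_sum]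
    congr 1
    refine Finset.sum_congr rfl fun k _ => ?_
    rw [FormalMultilinearSeries.apply_eq_pow_smul_coeff, zpow_sub₀ ht', smul_eq_mul]
    simp only [zpow_natCast]
    ring
  obtain ⟨C₁, hC₁, hO⟩ := (hp.isBigO_sub_partialSum_pow (c + n)).exists_pos
  obtain ⟨ε₀, hε₀, hball⟩ := Metric.eventually_nhds_iff.1 hO.bound
  set ε := min ε₀ 1 with hε
  have hεpos : 0 < ε := lt_min hε₀ one_pos
  obtain ⟨M, hM⟩ := isCompact_Icc.exists_bound_of_continuousOn
    (hcont.mono fun t (ht : t ∈ Icc ε 1) => lt_of_lt_of_le hεpos ht.1)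
  have hM0 : 0 ≤ M := (norm_nonneg _).trans (hM 1 ⟨min_le_right _ _, le_rfl⟩)
  have hB0 : 0 ≤ B := (norm_nonneg _).trans (hB 1 le_rfl)
  set A := ∑ k ∈ Finset.range (c + n), ‖p.coeff k‖
  have hA0 : 0 ≤ A := Finset.sum_nonneg fun _ _ => norm_nonneg _
  have hMε : 0 ≤ M / ε ^ n := by positivity
  refine ⟨C₁ + M / ε ^ n + (B + A), fun t ht => ?_⟩
  have htn : 0 ≤ t ^ (n : ℤ) := by positivity
  rcases lt_or_ge t ε with h1 | h1
  · have h2 := hball (y := (t : ℂ)) (by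
      rw [dist_zero_right, Complex.norm_real, Real.norm_of_nonneg ht.le]
      exact h1.trans_le (min_le_left _ _))
    simp only [zero_add, Complex.norm_real, Real.norm_of_nonneg ht.le, norm_pow] at h2
    have h3 : ‖laurentRem Q c p.coeff n t‖ ≤ C₁ * t ^ (n : ℤ) := by
      rw [hrem t ht, norm_mul, norm_inv, norm_pow, Complex.norm_real, Real.norm_of_nonneg ht.le,
        inv_mul_le_iff₀ (by positivity)]
      refine h2.trans (le_of_eq ?_)
      rw [zpow_natCast, pow_add]; ring
    nlinarith
  · rcases le_total t 1 with h2 | h2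
    · have h3 : M ≤ M / ε ^ n * t ^ (n : ℤ) := by
        rw [div_mul_eq_mul_div, le_div_iff₀ (by positivity), zpow_natCast]
        gcongr
      have := hM t ⟨h1, h2⟩
      nlinarith
    · have h3 : B ≤ B * t ^ (n : ℤ) := le_mul_of_one_le_right hB0 (by
        rw [zpow_natCast]; exact one_le_pow₀ h2)
      have h4 := sum_zpow_bound p.coeff c n h2
      have h5 : ‖laurentRem Q c p.coeff n t‖ ≤ B + A * t ^ (n : ℤ) :=
        (norm_sub_le _ _).trans (add_le_add (hB t h2) h4)
      nlinarith

/-- The entire function `(1 - e^{-ωz}) / z`. -/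
def expQuot (ω : ℝ) : ℂ → ℂ := dslope (fun z : ℂ => 1 - Complex.exp (-(ω * z))) 0

theorem analyticAt_expQuot (ω : ℝ) (z : ℂ) : AnalyticAt ℂ (expQuot ω) z := by
  have h : DifferentiableOn ℂ (expQuot ω) univ :=
    (Complex.differentiableOn_dslope univ_mem).2 (by fun_prop)
  exact h.analyticAt univ_mem

theorem mul_expQuot (ω : ℝ) (z : ℂ) : z * expQuot ω z = 1 - Complex.exp (-(ω * z)) := by
  have := sub_smul_dslope (fun z : ℂ => 1 - Complex.exp (-(ω * z))) 0 z
  simpa [expQuot] using this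

theorem expQuot_zero (ω : ℝ) : expQuot ω 0 = ω := by
  rw [expQuot, dslope_same]
  have h : HasDerivAt (fun z : ℂ => -(ω * z)) (-(ω * 1) : ℂ) 0 :=
    ((hasDerivAt_id (0 : ℂ)).const_mul (ω : ℂ)).fun_neg
  have := (h.cexp.const_sub 1).deriv
  simpa using this

theorem one_sub_cexp_ne_zero {ω t : ℝ} (hω : 0 < ω) (ht : 0 < t) :
    1 - Complex.exp (-(ω * t)) ≠ 0 := by
  intro h
  have h1 : ((1 - Real.exp (-(ω * t)) : ℝ) : ℂ) = 0 := by push_cast; exact h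
  have h2 : Real.exp (-(ω * t)) < 1 := Real.exp_lt_one_iff.2 (by nlinarith)
  have h3 : 1 - Real.exp (-(ω * t)) = 0 := by exact_mod_cast h1
  linarith

/-! ### Multiple series -/

section MultipleSeries

variable {r : ℕ}

/-- The product of absolutely convergent series, as a series over multi-indices. -/
theorem hasSum_prod_pi {f : Fin r → ℕ → ℂ} (hf : ∀ i, Summable fun n => ‖f i n‖) :
    (Summable fun k : Fin r → ℕ => ‖∏ i, f i (k i)‖) ∧
      HasSum (fun k : Fin r → ℕ => ∏ i, f i (k i)) (∏ i, ∑' n, f i n) := by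
  induction r with
  | zero =>
    exact ⟨(hasSum_fintype _).summable, by simp⟩
  | succ r ih =>
    obtain ⟨h1, h2⟩ := ih (f := fun i => f i.succ) fun i => hf i.succ
    set g : (Fin r → ℕ) → ℂ := fun k => ∏ i : Fin r, f i.succ (k i) with hg
    have h3 : Summable fun p : ℕ × (Fin r → ℕ) => ‖f 0 p.1 * g p.2‖ := (hf 0).mul_norm h1
    have h4 : HasSum (fun p : ℕ × (Fin r → ℕ) => f 0 p.1 * g p.2)
        ((∑' n, f 0 n) * ∏ i : Fin r, ∑' n, f i.succ n) :=
      HasSum.mul (hf 0).of_norm.hasSum h2 h3.of_norm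
    let e : ℕ × (Fin r → ℕ) ≃ (Fin (r + 1) → ℕ) := Fin.consEquiv fun _ => ℕ
    have he : ∀ p : ℕ × (Fin r → ℕ),
        ∏ i, f i (e p i) = f 0 p.1 * g p.2 := fun p => by
      rw [Fin.prod_univ_succ]; rfl
    rw [Fin.prod_univ_succ]
    refine ⟨e.summable_iff.1 (h3.congr fun p => ?_), e.hasSum_iff.1 ?_⟩
    · simp only [Function.comp_apply, he]
    · rwa [show (fun k : Fin (r + 1) → ℕ => ∏ i, f i (k i)) ∘ e = fun p => f 0 p.1 * g p.2 from
        funext he]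

/-- The linear form `k_1 ω_1 + ⋯ + k_r ω_r`. -/
def dot (ω : Fin r → ℝ) (k : Fin r → ℕ) : ℝ := ∑ i, (k i : ℝ) * ω i

theorem ofReal_dot (ω : Fin r → ℝ) (k : Fin r → ℕ) :
    (dot ω k : ℂ) = ∑ i, (k i : ℂ) * (ω i : ℂ) := by
  simp [dot]

variable {ω : Fin r → ℝ}

theorem dot_nonneg (hω : ∀ i, 0 < ω i) (k : Fin r → ℕ) : 0 ≤ dot ω k :=
  Finset.sum_nonneg fun i _ => mul_nonneg (Nat.cast_nonneg _) (hω i).le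

theorem finite_dot_lt (hω : ∀ i, 0 < ω i) (σ : ℝ) : {k : Fin r → ℕ | dot ω k < σ}.Finite := by
  refine (Set.finite_Iic fun i => ⌈σ / ω i⌉₊).subset fun k (hk : dot ω k < σ) i => ?_
  have h1 : (k i : ℝ) * ω i ≤ dot ω k :=
    Finset.single_le_sum (f := fun i => (k i : ℝ) * ω i)
      (fun i _ => mul_nonneg (Nat.cast_nonneg _) (hω i).le) (Finset.mem_univ i)
  have h2 : (k i : ℝ) ≤ σ / ω i := by rw [le_div_iff₀ (hω i)]; linarith
  exact_mod_cast h2.trans (Nat.le_ceil _)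

theorem exists_dot_ge (hω : ∀ i, 0 < ω i) :
    ∃ m : ℝ, 0 < m ∧ ∀ k : Fin r → ℕ, m * ∑ i, (k i : ℝ) ≤ dot ω k := by
  have hs : 0 ≤ ∑ i, (ω i)⁻¹ := Finset.sum_nonneg fun i _ => (inv_pos.2 (hω i)).le
  refine ⟨(1 + ∑ i, (ω i)⁻¹)⁻¹, by positivity, fun k => ?_⟩
  rw [Finset.mul_sum, dot]
  refine Finset.sum_le_sum fun i _ => ?_
  rw [mul_comm]
  gcongr
  rw [inv_le_comm₀ (by positivity) (hω i)]
  have := Finset.single_le_sum (f := fun i => (ω i)⁻¹)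
      (fun i _ => (inv_pos.2 (hω i)).le) (Finset.mem_univ i)
  linarith

theorem norm_cpow_neg_le (z w : ℂ) :
    ‖z ^ (-w)‖ ≤ ‖z‖ ^ (-w.re) * Real.exp (Real.pi * |w.im|) := by
  refine (Complex.norm_cpow_le z (-w)).trans ?_
  rw [div_eq_mul_inv, ← Real.exp_neg, Complex.neg_re, Complex.neg_im]
  refine mul_le_mul_of_nonneg_left (Real.exp_le_exp.2 ?_) (by positivity)
  have h1 := abs_mul z.arg w.im
  have h2 := Complex.abs_arg_le_pi z
  have h3 := le_abs_self (z.arg * w.im)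
  nlinarith [abs_nonneg w.im]

/-- Absolute convergence of the multiple series for `Re w > r`: all but finitely many terms
satisfy `‖kω + x‖ ≥ c ∏ (k_i + 1)^{1/r}`. -/
theorem summable_norm_cpow_dot (hω : ∀ i, 0 < ω i) (x : ℂ) {w : ℂ} (hw : (r : ℝ) < w.re) :
    Summable fun k : Fin r → ℕ => ‖((dot ω k : ℂ) + x) ^ (-w)‖ := by
  obtain ⟨m, hm, hdot⟩ := exists_dot_ge hω
  set v := w.re with hv
  have hr0 : (0 : ℝ) ≤ r := r.cast_nonneg
  have hv0 : 0 < v := by linarith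
  have hprod : Summable fun k : Fin r → ℕ => ∏ i : Fin r, ((k i : ℝ) + 1) ^ (-(v / r)) := by
    have h := (hasSum_prod_pi (r := r) (f := fun _ n => (((n : ℝ) + 1) ^ (-(v / r)) : ℝ))
      fun i => ?_).1
    · refine h.congr fun k => ?_
      rw [← Complex.ofReal_prod, Complex.norm_real, Real.norm_of_nonneg]
      exact Finset.prod_nonneg fun i _ => by positivity
    · have hr : (0 : ℝ) < r := by exact_mod_cast i.pos
      have h1 : 1 < v / r := by rw [one_lt_div hr]; exact hw
      have h2 := (summable_nat_add_iff 1).2 (Real.summable_nat_rpow_inv.2 h1)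
      refine h2.congr fun n => ?_
      rw [Complex.norm_real, Real.norm_of_nonneg (by positivity), Real.rpow_neg (by positivity)]
      push_cast
      rfl
  refine Summable.of_norm_bounded_eventually
    (hprod.mul_left ((m / 2) ^ (-v) * Real.exp (Real.pi * |w.im|))) ?_
  have hfin := finite_dot_lt hω (2 * ‖x‖ + m)
  refine hfin.subset fun k hk => ?_
  by_contra hge
  apply hk
  simp only [Set.mem_ofPred_eq, not_lt] at hge
  change ‖‖((dot ω k : ℂ) + x) ^ (-w)‖‖ ≤ _
  rw [norm_norm]
  set S := ∑ i, (k i : ℝ) with hS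
  have hS0 : 0 ≤ S := Finset.sum_nonneg fun i _ => Nat.cast_nonneg _
  have h1 : m / 2 * (S + 1) ≤ ‖(dot ω k : ℂ) + x‖ := by
    have h2 : ‖(dot ω k : ℂ)‖ = dot ω k := by
      rw [Complex.norm_real, Real.norm_of_nonneg (dot_nonneg hω k)]
    have h3 := norm_sub_le_norm_add (dot ω k : ℂ) x
    have h4 := hdot k
    rw [h2] at h3
    linarith
  have h5 : (S + 1) ^ (-v) ≤ ∏ i : Fin r, ((k i : ℝ) + 1) ^ (-(v / r)) := by
    have h6 : (S + 1) ^ (-v) = ∏ i : Fin r, (S + 1) ^ (-(v / r)) := by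
      rw [Finset.prod_const, Finset.card_univ, Fintype.card_fin,
        ← Real.rpow_mul_natCast (by positivity)]
      rcases Nat.eq_zero_or_pos r with rfl | hr
      · simp [hS]
      · congr 1; field_simp
    rw [h6]
    refine Finset.prod_le_prod (fun i _ => by positivity) fun i _ => ?_
    refine Real.rpow_le_rpow_of_nonpos (by positivity) ?_ (by
      rw [neg_nonpos]; positivity)
    have := Finset.single_le_sum (f := fun i => (k i : ℝ))
      (fun i _ => Nat.cast_nonneg _) (Finset.mem_univ i)
    linarith
  calc ‖((dot ω k : ℂ) + x) ^ (-w)‖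
      ≤ ‖(dot ω k : ℂ) + x‖ ^ (-v) * Real.exp (Real.pi * |w.im|) := norm_cpow_neg_le _ _
    _ ≤ (m / 2 * (S + 1)) ^ (-v) * Real.exp (Real.pi * |w.im|) := by
        gcongr 1
        exact Real.rpow_le_rpow_of_nonpos (by positivity) h1 (by linarith)
    _ = (m / 2) ^ (-v) * Real.exp (Real.pi * |w.im|) * (S + 1) ^ (-v) := by
        rw [Real.mul_rpow (by positivity) (by positivity)]; ring
    _ ≤ _ := by gcongr

end MultipleSeries

/-! ### The multiple Hurwitz zeta function -/

section Hurwitz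

variable {r : ℕ} {ω : Fin r → ℝ}

/-- The sum of `e^{-(kω - σ)t}` over all multi-indices `k` outside the finite set `K`. -/
def truncGeom (ω : Fin r → ℝ) (σ : ℝ) (K : Finset (Fin r → ℕ)) (t : ℝ) : ℂ :=
  Complex.exp (σ * t) * (∏ i, (1 - Complex.exp (-(ω i * t)))⁻¹ -
    ∑ k ∈ K, Complex.exp (-(dot ω k * t)))

open Classical in
/-- The terms of the series `truncGeom`, with `0` for the omitted multi-indices. -/
def truncTerm (ω : Fin r → ℝ) (σ : ℝ) (K : Finset (Fin r → ℕ)) (k : Fin r → ℕ) (t : ℝ) : ℂ :=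
  if k ∈ K then 0 else Complex.exp (-(((dot ω k - σ : ℝ) : ℂ) * t))

theorem exists_finset_dot_ge (hω : ∀ i, 0 < ω i) (σ : ℝ) :
    ∃ K : Finset (Fin r → ℕ), ∀ k, k ∉ K → σ ≤ dot ω k := by
  refine ⟨(finite_dot_lt hω σ).toFinset, fun k hk => ?_⟩
  simpa using hk

theorem hasSum_geom (hω : ∀ i, 0 < ω i) {t : ℝ} (ht : 0 < t) :
    (Summable fun k : Fin r → ℕ => ‖Complex.exp (-(dot ω k * t))‖) ∧
    HasSum (fun k : Fin r → ℕ => Complex.exp (-(dot ω k * t)))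
      (∏ i, (1 - Complex.exp (-(ω i * t)))⁻¹) := by
  have hlt : ∀ i, ‖Complex.exp (-(ω i * t))‖ < 1 := fun i => by
    rw [norm_cexp_neg_mul, Real.exp_lt_one_iff, Complex.ofReal_re]
    nlinarith [mul_pos (hω i) ht]
  have h := hasSum_prod_pi (r := r) (f := fun i n => Complex.exp (-(ω i * t)) ^ n)
    fun i => by
      simp only [norm_pow]
      exact summable_geometric_of_lt_one (norm_nonneg _) (hlt i)
  have e : ∀ k : Fin r → ℕ, ∏ i, Complex.exp (-(ω i * t)) ^ (k i) =
      Complex.exp (-(dot ω k * t)) := fun k => by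
    simp only [← Complex.exp_nat_mul, ← Complex.exp_sum]
    congr 1
    rw [ofReal_dot, Finset.sum_mul, ← Finset.sum_neg_distrib]
    exact Finset.sum_congr rfl fun i _ => by ring
  simp only [e, fun i => tsum_geometric_of_norm_lt_one (hlt i)] at h
  exact h

theorem hasSum_truncTerm (hω : ∀ i, 0 < ω i) (σ : ℝ) (K : Finset (Fin r → ℕ)) {t : ℝ}
    (ht : 0 < t) :
    (Summable fun k => ‖truncTerm ω σ K k t‖) ∧
      HasSum (fun k => truncTerm ω σ K k t) (truncGeom ω σ K t) := by
  classical
  obtain ⟨h1, h2⟩ := hasSum_geom hω ht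
  have e : ∀ k, truncTerm ω σ K k t = Complex.exp (σ * t) * (Complex.exp (-(dot ω k * t)) -
      if k ∈ K then Complex.exp (-(dot ω k * t)) else 0) := fun k => by
    rw [truncTerm]
    split_ifs
    · simp
    · rw [sub_zero, ← Complex.exp_add]
      congr 1; push_cast; ring
  constructor
  · refine Summable.of_nonneg_of_le (fun k => norm_nonneg _) (fun k => ?_)
      (h1.mul_left ‖Complex.exp (σ * t)‖)
    rw [e, norm_mul]
    gcongr
    split_ifs <;> simp
  · simp only [e]
    refine HasSum.mul_left _ (h2.sub ?_)
    have : HasSum (fun k => if k ∈ K then Complex.exp (-(dot ω k * t)) else 0)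
        (∑ k ∈ K, if k ∈ K then Complex.exp (-(dot ω k * t)) else 0) :=
      hasSum_sum_of_ne_finset_zero fun k hk => by simp [hk]
    rwa [Finset.sum_congr rfl fun k hk => if_pos hk] at this

/-- The pole at `0` comes from the product of the `r` geometric series; boundedness on `[1, ∞)`
comes from the exponents `kω - σ` being nonnegative for `k ∉ K`. -/
theorem exists_hasLaurentBound_truncGeom (hω : ∀ i, 0 < ω i) {σ : ℝ}
    {K : Finset (Fin r → ℕ)} (hK : ∀ k, k ∉ K → σ ≤ dot ω k) :
    ∃ a, HasLaurentBound (truncGeom ω σ K) r a := by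
  have hne : ∀ i, ∀ t : ℝ, 0 < t → 1 - Complex.exp (-(ω i * t)) ≠ 0 := fun i t ht =>
    one_sub_cexp_ne_zero (hω i) ht
  have key := exists_hasLaurentBound (Q := truncGeom ω σ K) (c := r)
    (H := fun z => Complex.exp (σ * z) * (∏ i, (expQuot (ω i) z)⁻¹ -
      z ^ r * ∑ k ∈ K, Complex.exp (-(dot ω k * z))))
    (B := ∑' k, ‖truncTerm ω σ K k 1‖) ?_ ?_ ?_ ?_
  · obtain ⟨a, ha, -⟩ := key
    exact ⟨a, ha⟩
  · refine ContinuousOn.mul (by fun_prop) (ContinuousOn.sub ?_ (by fun_prop))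
    exact continuousOn_finsetProd _ fun i _ => ContinuousOn.inv₀ (by fun_prop) (hne i)
  · intro t ht
    obtain ⟨h1, h2⟩ := hasSum_truncTerm hω σ K (t := t) (by linarith)
    rw [← h2.tsum_eq]
    refine (norm_tsum_le_tsum_norm h1).trans (h1.tsum_le_tsum (fun k => ?_)
      (hasSum_truncTerm hω σ K one_pos).1)
    rw [truncTerm, truncTerm]
    split_ifs with hk
    · simp
    · rw [norm_cexp_neg_mul, norm_cexp_neg_mul, Real.exp_le_exp, Complex.ofReal_re]
      have := hK k hk
      nlinarith
  · refine AnalyticAt.fun_mul (by fun_prop) (AnalyticAt.fun_sub ?_ (by fun_prop))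
    refine Finset.analyticAt_fun_prod _ fun i _ => (analyticAt_expQuot _ _).fun_inv ?_
    rw [expQuot_zero]
    exact_mod_cast (hω i).ne'
  · intro t ht
    have ht' : (t : ℂ) ≠ 0 := by exact_mod_cast ht.ne'
    have e : ∏ i, (expQuot (ω i) t)⁻¹ =
        (t : ℂ) ^ r * ∏ i, (1 - Complex.exp (-(ω i * t)))⁻¹ := by
      simp only [← mul_expQuot, mul_inv, Finset.prod_mul_distrib, Finset.prod_const,
        Finset.card_univ, Fintype.card_fin]
      rw [inv_pow, mul_inv_cancel_left₀ (pow_ne_zero _ ht')]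
    rw [truncGeom, e]
    ring

theorem lapMellin_exp {w : ℂ} (hw : 0 < w.re) {y d : ℂ} (hy : 0 < (d + y).re) :
    lapMellin (fun t => Complex.exp (-(d * t))) w y = (d + y) ^ (-w) * Complex.Gamma w := by
  rw [← lapMellin_one hw hy, lapMellin, lapMellin]
  congr 1
  funext t
  rw [← Complex.exp_add, mul_one]
  congr 1; ring

open Classical in
/-- Termwise integration of the truncated series, for `Re w > r`. -/
theorem lapMellin_truncGeom (hω : ∀ i, 0 < ω i) {σ : ℝ} {K : Finset (Fin r → ℕ)}
    (hK : ∀ k, k ∉ K → σ ≤ dot ω k) {w y : ℂ} (hw : (r : ℝ) < w.re) (hy : 0 < y.re) :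
    HasSum (fun k => if k ∈ K then 0 else ((dot ω k : ℂ) + (y - σ)) ^ (-w))
      ((Complex.Gamma w)⁻¹ * lapMellin (truncGeom ω σ K) w y) := by
  have hr0 : (0 : ℝ) ≤ r := r.cast_nonneg
  have hw0 : 0 < w.re := by linarith
  have hpos : ∀ k, k ∉ K → 0 < dot ω k - σ + y.re := fun k hk => by
    have := hK k hk; linarith
  have hpos' : ∀ k, k ∉ K → 0 < (((dot ω k - σ : ℝ) : ℂ) + y).re := fun k hk => by
    simpa using hpos k hk
  have hterm : ∀ k, lapMellin (truncTerm ω σ K k) w y =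
      if k ∈ K then 0 else ((dot ω k : ℂ) + (y - σ)) ^ (-w) * Complex.Gamma w := fun k => by
    split_ifs with hk
    · simp [lapMellin, mellin, truncTerm, hk]
    · have e : truncTerm ω σ K k = fun t : ℝ => Complex.exp (-(((dot ω k - σ : ℝ) : ℂ) * t)) := by
        funext t; simp [truncTerm, hk]
      rw [e, lapMellin_exp hw0 (hpos' k hk)]
      congr 2; push_cast; ring
  have hnorm : ∀ k, ∀ t ∈ Ioi (0 : ℝ), ‖(t : ℂ) ^ (w - 1) •
      (Complex.exp (-(y * t)) * truncTerm ω σ K k t)‖ =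
      if k ∈ K then 0 else t ^ (w.re - 1) * Real.exp (-((dot ω k - σ + y.re) * t)) := by
    intro k t (ht : 0 < t)
    rw [truncTerm]
    split_ifs with hk
    · simp
    · rw [norm_smul, norm_mul, norm_cexp_neg_mul, norm_cexp_neg_mul,
        Complex.norm_cpow_eq_rpow_re_of_pos ht, ← Real.exp_add]
      simp only [Complex.sub_re, Complex.one_re, Complex.ofReal_re]
      congr 2; ring
  have hsum : Summable fun k => ∫ t in Ioi (0 : ℝ), ‖(t : ℂ) ^ (w - 1) •
      (Complex.exp (-(y * t)) * truncTerm ω σ K k t)‖ := by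
    have h := summable_norm_cpow_dot hω ((y.re - σ : ℝ) : ℂ) (w := (w.re : ℂ)) (by simpa using hw)
    refine Summable.of_nonneg_of_le (fun k => integral_nonneg fun t => norm_nonneg _) (fun k => ?_)
      (h.mul_right (Real.Gamma w.re))
    rw [setIntegral_congr_fun measurableSet_Ioi (hnorm k)]
    split_ifs with hk
    · rw [integral_zero]
      exact mul_nonneg (norm_nonneg _) (Real.Gamma_pos_of_pos hw0).le
    · rw [Real.integral_rpow_mul_exp_neg_mul_Ioi hw0 (hpos k hk), ← Complex.ofReal_add,
        Complex.norm_cpow_eq_rpow_re_of_pos (by have := hpos k hk; linarith), one_div,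
        Real.inv_rpow (hpos k hk).le, ← Real.rpow_neg (hpos k hk).le]
      refine le_of_eq ?_
      congr 2
      ring
  have hint : ∀ k, Integrable (fun t : ℝ => (t : ℂ) ^ (w - 1) •
      (Complex.exp (-(y * t)) * truncTerm ω σ K k t)) (volume.restrict (Ioi 0)) := by
    intro k
    refine mellinConvergent_exp_mul (n := 0) (C := 1) ?_ (fun t ht => ?_) (by simpa using hw0) hy
    · unfold truncTerm
      split_ifs <;> fun_prop
    · rw [truncTerm]
      split_ifs with hk
      · simp
      · rw [norm_cexp_neg_mul, zpow_zero, mul_one, Real.exp_le_one_iff, Complex.ofReal_re]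
        have := hK k hk
        nlinarith
  have key := hasSum_integral_of_summable_integral_norm hint hsum
  have e : ∫ t in Ioi (0 : ℝ), ∑' k, (t : ℂ) ^ (w - 1) •
      (Complex.exp (-(y * t)) * truncTerm ω σ K k t) = lapMellin (truncGeom ω σ K) w y := by
    refine setIntegral_congr_fun measurableSet_Ioi fun t ht => ?_
    simp only [smul_eq_mul]
    rw [tsum_mul_left, tsum_mul_left, (hasSum_truncTerm hω σ K ht).2.tsum_eq]
  rw [e] at key
  have key2 := key.mul_left (Complex.Gamma w)⁻¹
  have e2 : (fun k => if k ∈ K then 0 else ((dot ω k : ℂ) + (y - σ)) ^ (-w)) =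
      fun k => (Complex.Gamma w)⁻¹ * lapMellin (truncTerm ω σ K k) w y := by
    funext k
    have := Complex.Gamma_ne_zero_of_re_pos hw0
    rw [hterm k]
    split_ifs
    · simp
    · field_simp
  rw [e2]
  exact key2

/-- The multiple Hurwitz zeta function at `x`, as the sum of the continuation of the integral that
represents the series over `k ∉ K`, and of the finitely many terms with `k ∈ K`. -/
def hurwitzExt (ω : Fin r → ℝ) (σ : ℝ) (K : Finset (Fin r → ℕ)) (a : ℕ → ℂ) (w x : ℂ) : ℂ :=
  lapCont (truncGeom ω σ K) r a w (x + σ) + ∑ k ∈ K, ((dot ω k : ℂ) + x) ^ (-w)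

theorem hurwitzExt_eq_series (hω : ∀ i, 0 < ω i) {σ : ℝ} {K : Finset (Fin r → ℕ)}
    (hK : ∀ k, k ∉ K → σ ≤ dot ω k) {a : ℕ → ℂ} (ha : HasLaurentBound (truncGeom ω σ K) r a)
    {w x : ℂ} (hw : (r : ℝ) < w.re) (hx : -σ < x.re) :
    hurwitzExt ω σ K a w x = multHurwitzSeries w x ω := by
  classical
  have hy : 0 < (x + σ).re := by simp; linarith
  have h1 := lapMellin_truncGeom hω hK hw hy
  have h2 : HasSum (fun k => if k ∈ K then ((dot ω k : ℂ) + x) ^ (-w) else 0)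
      (∑ k ∈ K, if k ∈ K then ((dot ω k : ℂ) + x) ^ (-w) else 0) :=
    hasSum_sum_of_ne_finset_zero fun k hk => by simp [hk]
  rw [Finset.sum_congr rfl fun k hk => if_pos hk] at h2
  have h3 := h1.add h2
  rw [hurwitzExt, ha.lapCont_eq_mellin hw hy, ← h3.tsum_eq, multHurwitzSeries]
  refine tsum_congr fun k => ?_
  rw [← ofReal_dot]
  split_ifs <;> simp

theorem dot_add_ne_zero {x : ℂ} (hx : x ∉ multGammaPoles ω) (k : Fin r → ℕ) :
    (dot ω k : ℂ) + x ≠ 0 := fun h => hx ⟨k, by rw [← ofReal_dot]; exact h⟩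

theorem analyticAt_hurwitzExt {σ : ℝ} {K : Finset (Fin r → ℕ)}
    {a : ℕ → ℂ} (ha : HasLaurentBound (truncGeom ω σ K) r a) {w x : ℂ}
    (hxσ : -σ < x.re) (hx : x ∉ multGammaPoles ω) (hw : ∀ j ∈ Finset.Icc 1 r, w ≠ (j : ℂ)) :
    AnalyticAt ℂ (fun w => hurwitzExt ω σ K a w x) w :=
  (ha.analyticAt_lapCont (by simp; linarith) hw).fun_add
    (Finset.analyticAt_fun_sum _ fun k _ => analyticAt_cpow_neg (dot_add_ne_zero hx k) w)

/-- For `Re x > -σ` outside the pole set, the multiple Hurwitz zeta function is given by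
`hurwitzExt`. -/
theorem multHurwitz_spec (hω : ∀ i, 0 < ω i) {σ : ℝ} {K : Finset (Fin r → ℕ)}
    (hK : ∀ k, k ∉ K → σ ≤ dot ω k) {a : ℕ → ℂ} (ha : HasLaurentBound (truncGeom ω σ K) r a)
    {x : ℂ} (hxσ : -σ < x.re) (hx : x ∉ multGammaPoles ω) :
    IsMeroContinuation (fun w => multHurwitzSeries w x ω) (fun w => multHurwitz w x ω) ∧
      ∀ w : ℂ, (∀ j ∈ Finset.Icc 1 r, w ≠ (j : ℂ)) →
        (fun w => multHurwitz w x ω) =ᶠ[𝓝 w] fun w => hurwitzExt ω σ K a w x := by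
  have h := meroContinuation_spec (F := fun w => multHurwitzSeries w x ω)
    (G := fun w => hurwitzExt ω σ K a w x) (fun w _ => ?_) r (fun w hw => ?_) (fun w hw => ?_)
  · exact ⟨h.1, fun w hw => h.2 w (analyticAt_hurwitzExt ha hxσ hx hw)⟩
  · exact (ha.meromorphicAt_lapCont w (by simp; linarith)).fun_add
      (Finset.analyticAt_fun_sum _ fun k _ =>
        analyticAt_cpow_neg (dot_add_ne_zero hx k) w).meromorphicAt
  · exact analyticAt_hurwitzExt ha hxσ hx (ne_natCast_of_lt_re hw)
  · exact hurwitzExt_eq_series hω hK ha hw hxσ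

theorem exists_hurwitzExt (hω : ∀ i, 0 < ω i) (σ : ℝ) :
    ∃ (K : Finset (Fin r → ℕ)) (a : ℕ → ℂ), (∀ k, k ∉ K → σ ≤ dot ω k) ∧
      HasLaurentBound (truncGeom ω σ K) r a := by
  obtain ⟨K, hK⟩ := exists_finset_dot_ge hω σ
  obtain ⟨a, ha⟩ := exists_hasLaurentBound_truncGeom hω hK
  exact ⟨K, a, hK, ha⟩

theorem multHurwitz_eq_series (hω : ∀ i, 0 < ω i) {w x : ℂ} (hx : x ∉ multGammaPoles ω)
    (hw : (r : ℝ) < w.re) : multHurwitz w x ω = multHurwitzSeries w x ω := by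
  obtain ⟨K, a, hK, ha⟩ := exists_hurwitzExt hω (-x.re + 1)
  have hxσ : -(-x.re + 1) < x.re := by linarith
  rw [((multHurwitz_spec hω hK ha hxσ hx).2 w (ne_natCast_of_lt_re hw)).eq_of_nhds]
  exact hurwitzExt_eq_series hω hK ha hw hxσ

theorem analyticAt_multHurwitz (hω : ∀ i, 0 < ω i) {w x : ℂ} (hx : x ∉ multGammaPoles ω)
    (hw : ∀ j ∈ Finset.Icc 1 r, w ≠ (j : ℂ)) :
    AnalyticAt ℂ (fun w => multHurwitz w x ω) w := by
  obtain ⟨K, a, hK, ha⟩ := exists_hurwitzExt hω (-x.re + 1)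
  have hxσ : -(-x.re + 1) < x.re := by linarith
  exact (analyticAt_hurwitzExt ha hxσ hx hw).congr ((multHurwitz_spec hω hK ha hxσ hx).2 w hw).symm

theorem multHurwitzWellDefined (hω : ∀ i, 0 < ω i) : MultHurwitzWellDefined ω := by
  intro x hx
  obtain ⟨K, a, hK, ha⟩ := exists_hurwitzExt hω (-x.re + 1)
  have hxσ : -(-x.re + 1) < x.re := by linarith
  refine ⟨fun w hw => ⟨?_, multHurwitz_eq_series hω hx hw⟩,
    (multHurwitz_spec hω hK ha hxσ hx).1, fun w hw => analyticAt_multHurwitz hω hx hw⟩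
  simpa only [ofReal_dot] using (summable_norm_cpow_dot hω x hw).of_norm

theorem notMem_poles_of_mem_slitPlane (hω : ∀ i, 0 < ω i) {x : ℂ} (hx : x ∈ Complex.slitPlane) :
    x ∉ multGammaPoles ω := by
  rintro ⟨k, hk⟩
  rw [← ofReal_dot] at hk
  have h1 : x = ((-dot ω k : ℝ) : ℂ) := by push_cast; linear_combination hk
  rw [h1, Complex.ofReal_mem_slitPlane] at hx
  linarith [dot_nonneg hω k]

/-- On the slit plane no term of the series meets the branch cut of the logarithm. -/
theorem differentiableAt_multHurwitz_right (hω : ∀ i, 0 < ω i) {w x : ℂ}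
    (hw : ∀ j ∈ Finset.Icc 1 r, w ≠ (j : ℂ)) (hx : x ∈ Complex.slitPlane) :
    DifferentiableAt ℂ (fun x => multHurwitz w x ω) x := by
  set σ := -x.re + 1 with hσ
  obtain ⟨K, a, hK, ha⟩ := exists_hurwitzExt hω σ
  have ho : IsOpen ({z : ℂ | -σ < z.re} ∩ Complex.slitPlane) :=
    (isOpen_lt continuous_const Complex.continuous_re).inter Complex.isOpen_slitPlane
  have he : (fun x => multHurwitz w x ω) =ᶠ[𝓝 x] fun x => hurwitzExt ω σ K a w x := by
    refine mem_of_superset (ho.mem_nhds ⟨by simp [hσ], hx⟩) fun z hz => ?_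
    exact ((multHurwitz_spec hω hK ha hz.1
      (notMem_poles_of_mem_slitPlane hω hz.2)).2 w hw).eq_of_nhds
  refine DifferentiableAt.congr_of_eventuallyEq ?_ he
  refine DifferentiableAt.fun_add ?_ (DifferentiableAt.fun_sum fun k _ => ?_)
  · exact (ha.differentiableAt_lapCont_right w (y := x + σ) (by simp [hσ])).comp x
      (differentiableAt_id.add_const _)
  · refine (differentiableAt_id.const_add _).cpow_const ?_
    rcases hx with h | h
    · left
      have := dot_nonneg hω k
      simp; linarith
    · right; simpa using h

end Hurwitz

/-! ### The multiple gamma function -/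

section MultGamma

variable {r : ℕ} {ω : Fin r → ℝ}

/-- The factorization of the multiple gamma function on the half-plane `Re x > -σ` into a
zero-free holomorphic function and the finitely many factors responsible for the poles. -/
def gammaExt (ω : Fin r → ℝ) (σ : ℝ) (K : Finset (Fin r → ℕ)) (a : ℕ → ℂ) (x : ℂ) : ℂ :=
  Complex.exp (lapDeriv (truncGeom ω σ K) r a (x + σ)) * ∏ k ∈ K, ((dot ω k : ℂ) + x)⁻¹

theorem multGamma_eq_gammaExt (hω : ∀ i, 0 < ω i) {σ : ℝ} {K : Finset (Fin r → ℕ)}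
    (hK : ∀ k, k ∉ K → σ ≤ dot ω k) {a : ℕ → ℂ} (ha : HasLaurentBound (truncGeom ω σ K) r a)
    {x : ℂ} (hxσ : -σ < x.re) (hx : x ∉ multGammaPoles ω) :
    multGamma x ω = gammaExt ω σ K a x := by
  have hd : HasDerivAt (fun w => hurwitzExt ω σ K a w x)
      (lapDeriv (truncGeom ω σ K) r a (x + σ) +
        ∑ k ∈ K, -Complex.log ((dot ω k : ℂ) + x)) 0 := by
    refine (ha.hasDerivAt_lapCont_zero (by simp; linarith)).fun_add
      (HasDerivAt.fun_sum fun k _ => ?_)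
    have := (hasDerivAt_id (0 : ℂ)).fun_neg.const_cpow (c := (dot ω k : ℂ) + x)
      (Or.inl (dot_add_ne_zero hx k))
    simpa using this
  rw [multGamma, ((multHurwitz_spec hω hK ha hxσ hx).2 0 (zero_ne_natCast r)).deriv_eq, hd.deriv,
    Complex.exp_add, Complex.exp_sum, gammaExt]
  congr 1
  refine Finset.prod_congr rfl fun k _ => ?_
  rw [Complex.exp_neg, Complex.exp_log (dot_add_ne_zero hx k)]

theorem multGamma_ne_zero (x : ℂ) : multGamma x ω ≠ 0 := Complex.exp_ne_zero _

/-- The points of `multGammaPoles ω` are isolated and form a closed set. -/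
theorem eventually_notMem_multGammaPoles (hω : ∀ i, 0 < ω i) (x : ℂ) :
    (∀ᶠ z in 𝓝[≠] x, z ∉ multGammaPoles ω) ∧
      (x ∉ multGammaPoles ω → ∀ᶠ z in 𝓝 x, z ∉ multGammaPoles ω) := by
  obtain ⟨K, hK⟩ := exists_finset_dot_ge hω (-x.re + 1)
  have hopen : IsOpen {z : ℂ | -(-x.re + 1) < z.re} :=
    isOpen_lt continuous_const Complex.continuous_re
  have hnhds : {z : ℂ | -(-x.re + 1) < z.re} ∈ 𝓝 x := hopen.mem_nhds (by simp)
  set S : Set ℂ := (fun k : Fin r → ℕ => -(dot ω k : ℂ)) '' K with hS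
  have hSfin : S.Finite := K.finite_toSet.image _
  have hmem : ∀ z : ℂ, -(-x.re + 1) < z.re → z ∈ multGammaPoles ω → z ∈ S := by
    rintro z hz ⟨k, hk⟩
    rw [← ofReal_dot] at hk
    have hzk : z = -(dot ω k : ℂ) := by linear_combination hk
    refine ⟨k, ?_, hzk.symm⟩
    by_contra hkK
    have := hK k hkK
    rw [hzk, Complex.neg_re, Complex.ofReal_re] at hz
    linarith
  have hSsub : ∀ z ∈ S, z ∈ multGammaPoles ω := by
    rintro z ⟨k, -, rfl⟩
    exact ⟨k, by rw [← ofReal_dot]; ring⟩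
  constructor
  · have h1 : (S \ {x})ᶜ ∈ 𝓝 x :=
      (hSfin.subset sdiff_subset).isClosed.isOpen_compl.mem_nhds (by simp)
    filter_upwards [nhdsWithin_le_nhds hnhds, nhdsWithin_le_nhds h1, self_mem_nhdsWithin]
      with z hz1 hz2 hz3 hz4
    exact hz2 ⟨hmem z hz1 hz4, hz3⟩
  · intro hx
    have h1 : Sᶜ ∈ 𝓝 x := hSfin.isClosed.isOpen_compl.mem_nhds fun h => hx (hSsub x h)
    filter_upwards [hnhds, h1] with z hz1 hz2 hz4
    exact hz2 (hmem z hz1 hz4)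

/-- `Γ_r` is meromorphic on `ℂ`, and analytic outside `multGammaPoles ω`. -/
theorem meromorphicAt_multGamma (hω : ∀ i, 0 < ω i) (x : ℂ) :
    MeromorphicAt (fun x => multGamma x ω) x ∧
      (x ∉ multGammaPoles ω → AnalyticAt ℂ (fun x => multGamma x ω) x) := by
  set σ := -x.re + 1 with hσ
  obtain ⟨K, a, hK, ha⟩ := exists_hurwitzExt hω σ
  have hopen : IsOpen {z : ℂ | -σ < z.re} := isOpen_lt continuous_const Complex.continuous_re
  have hxσ : x ∈ {z : ℂ | -σ < z.re} := by simp [hσ]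
  have hexp : AnalyticAt ℂ (fun x => Complex.exp (lapDeriv (truncGeom ω σ K) r a (x + σ))) x := by
    refine AnalyticAt.cexp ?_
    have hd : DifferentiableOn ℂ (fun x => lapDeriv (truncGeom ω σ K) r a (x + σ))
        {z : ℂ | -σ < z.re} := fun z (hz : -σ < z.re) =>
      ((ha.differentiableAt_lapDeriv (y := z + σ) (by simp; linarith)).comp z
        (differentiableAt_id.add_const _)).differentiableWithinAt
    exact hd.analyticAt (hopen.mem_nhds hxσ)
  obtain ⟨h1, h2⟩ := eventually_notMem_multGammaPoles hω x
  constructor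
  · refine MeromorphicAt.congr (f := gammaExt ω σ K a) ?_ ?_
    · refine hexp.meromorphicAt.mul (MeromorphicAt.fun_prod fun k _ => ?_)
      exact MeromorphicAt.fun_inv (by fun_prop)
    · filter_upwards [h1, nhdsWithin_le_nhds (hopen.mem_nhds hxσ)] with z hz1 hz2
      exact (multGamma_eq_gammaExt hω hK ha hz2 hz1).symm
  · intro hx
    refine AnalyticAt.congr (f := gammaExt ω σ K a) ?_ ?_
    · refine hexp.mul (Finset.analyticAt_fun_prod _ fun k _ => ?_)
      exact AnalyticAt.fun_inv (by fun_prop) (dot_add_ne_zero hx k)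
    · filter_upwards [h2 hx, hopen.mem_nhds hxσ] with z hz1 hz2
      exact (multGamma_eq_gammaExt hω hK ha hz2 hz1).symm

end MultGamma

/-! ### Quotients of products of `1 - e^{-kt}` -/

section Quotient

variable {a b : ℕ} {m : Fin a → ℕ} {n : Fin b → ℕ}

/-- The function `∏ (1 - e^{-m(i) t}) / ∏ (1 - e^{-n(j) t})`. -/
def expRatio (m : Fin a → ℕ) (n : Fin b → ℕ) (t : ℝ) : ℂ :=
  (∏ i, (1 - Complex.exp (-((m i : ℝ) * t)))) * ∏ j, (1 - Complex.exp (-((n j : ℝ) * t)))⁻¹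

theorem exists_hasLaurentBound_expRatio (hn : ∀ j, 0 < n j) (hab : a ≤ b) :
    ∃ α, HasLaurentBound (expRatio m n) (b - a) α ∧
      (a = b → α 0 = (∏ i, (m i : ℂ)) * ∏ j, (n j : ℂ)⁻¹) := by
  have hn' : ∀ j, (0 : ℝ) < n j := fun j => by exact_mod_cast hn j
  have key := exists_hasLaurentBound (Q := expRatio m n) (c := b - a)
    (H := fun z => (∏ i, expQuot (m i) z) * ∏ j, (expQuot (n j) z)⁻¹)
    (B := ∏ j, (1 - Real.exp (-(n j : ℝ)))⁻¹) ?_ ?_ ?_ ?_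
  · obtain ⟨α, hα, h0⟩ := key
    refine ⟨α, hα, fun h => ?_⟩
    rw [h0 (by omega)]
    simp [expQuot_zero]
  · refine ContinuousOn.mul (by fun_prop) ?_
    exact continuousOn_finsetProd _ fun j _ => ContinuousOn.inv₀ (by fun_prop)
      fun t ht => one_sub_cexp_ne_zero (hn' j) ht
  · intro t ht
    have hreal : ∀ c : ℝ, 1 - Complex.exp (-((c : ℝ) * t)) = ((1 - Real.exp (-(c * t)) : ℝ) : ℂ) :=
      fun c => by push_cast; rfl
    rw [expRatio, norm_mul, norm_prod, norm_prod]
    have h1 : ∏ i, ‖1 - Complex.exp (-((m i : ℝ) * t))‖ ≤ 1 := by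
      refine Finset.prod_le_one (fun _ _ => norm_nonneg _) fun i _ => ?_
      have h2 : Real.exp (-((m i : ℝ) * t)) ≤ 1 := Real.exp_le_one_iff.2 (by
        rw [neg_nonpos]; positivity)
      have h3 := Real.exp_pos (-((m i : ℝ) * t))
      rw [hreal, Complex.norm_real, Real.norm_of_nonneg (by linarith)]
      linarith
    have h2 : ∏ j, ‖(1 - Complex.exp (-((n j : ℝ) * t)))⁻¹‖ ≤
        ∏ j, (1 - Real.exp (-(n j : ℝ)))⁻¹ := by
      refine Finset.prod_le_prod (fun _ _ => norm_nonneg _) fun j _ => ?_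
      have h3 : Real.exp (-(n j : ℝ)) < 1 := Real.exp_lt_one_iff.2 (by have := hn' j; linarith)
      have h4 : Real.exp (-((n j : ℝ) * t)) ≤ Real.exp (-(n j : ℝ)) :=
        Real.exp_le_exp.2 (by nlinarith [hn' j])
      rw [norm_inv, hreal, Complex.norm_real, Real.norm_of_nonneg (by linarith)]
      exact inv_anti₀ (by linarith) (by linarith)
    calc _ ≤ 1 * ∏ j, (1 - Real.exp (-(n j : ℝ)))⁻¹ :=
          mul_le_mul h1 h2 (Finset.prod_nonneg fun _ _ => norm_nonneg _) zero_le_one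
      _ = _ := one_mul _
  · refine (Finset.analyticAt_fun_prod _ fun i _ => analyticAt_expQuot _ _).fun_mul
      (Finset.analyticAt_fun_prod _ fun j _ => (analyticAt_expQuot _ _).fun_inv ?_)
    rw [expQuot_zero]
    exact_mod_cast (hn j).ne'
  · intro t ht
    have ht' : (t : ℂ) ≠ 0 := by exact_mod_cast ht.ne'
    simp only [expRatio, ← mul_expQuot, mul_inv, Finset.prod_mul_distrib, Finset.prod_const,
      Finset.card_univ, Fintype.card_fin, inv_pow]
    obtain ⟨d, rfl⟩ := Nat.exists_eq_add_of_le hab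
    rw [Nat.add_sub_cancel_left, pow_add]
    field_simp

theorem lapMellin_exp_mul (R : ℝ → ℂ) (w y d : ℂ) :
    lapMellin (fun t => Complex.exp (-(d * t)) * R t) w y = lapMellin R w (y + d) := by
  rw [lapMellin, lapMellin]
  congr 1
  funext t
  rw [← mul_assoc, ← Complex.exp_add]
  congr 2; ring

theorem expRatio_eq_sum (t : ℝ) : expRatio m n t = ∑ I : Finset (Fin a), (-1 : ℂ) ^ I.card *
    (Complex.exp (-((∑ i ∈ I, (m i : ℂ)) * t)) * truncGeom (params n) 0 ∅ t) := by
  have h : ∏ i, (1 - Complex.exp (-((m i : ℝ) * t))) = ∑ I : Finset (Fin a),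
      (-1 : ℂ) ^ I.card * Complex.exp (-((∑ i ∈ I, (m i : ℂ)) * t)) := by
    simp only [sub_eq_add_neg, Finset.prod_one_add, Finset.powerset_univ]
    refine Finset.sum_congr rfl fun I _ => ?_
    rw [Finset.prod_neg, ← Complex.exp_sum, Finset.sum_neg_distrib, Finset.sum_mul]
    simp
  rw [expRatio, h, Finset.sum_mul]
  simp [truncGeom, params, mul_assoc]

/-- Term-by-term integration of the expanded numerator `∏ (1 - e^{-m(i)t})`. -/
theorem lapMellin_expRatio (hn : ∀ j, 0 < n j) {w y : ℂ} (hw : (b : ℝ) < w.re) (hy : 0 < y.re) :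
    (Complex.Gamma w)⁻¹ * lapMellin (expRatio m n) w y = ∑ I : Finset (Fin a), (-1 : ℂ) ^ I.card *
      multHurwitz w (y + ∑ i ∈ I, (m i : ℂ)) (params n) := by
  have hω : ∀ j, 0 < params n j := fun j => by simpa [params] using hn j
  have hK : ∀ k, k ∉ (∅ : Finset (Fin b → ℕ)) → 0 ≤ dot (params n) k :=
    fun k _ => dot_nonneg hω k
  obtain ⟨α, hα⟩ := exists_hasLaurentBound_truncGeom hω hK
  have hre : ∀ I : Finset (Fin a), 0 < (y + ∑ i ∈ I, (m i : ℂ)).re := fun I => by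
    have : (0 : ℝ) ≤ ∑ i ∈ I, (m i : ℝ) := Finset.sum_nonneg fun _ _ => Nat.cast_nonneg _
    rw [Complex.add_re, Complex.re_sum]
    simp only [Complex.natCast_re]
    linarith
  have key := lapMellin_sum_add (Finset.univ : Finset (Finset (Fin a))) (fun I => (-1) ^ I.card)
    (f := fun I (t : ℝ) => Complex.exp (-((∑ i ∈ I, (m i : ℂ)) * t)) * truncGeom (params n) 0 ∅ t)
    (g := fun _ => 0) (w := w) (y := y) (fun I _ => ?_) (by simp [MellinConvergent])
  · have e : expRatio m n = fun t : ℝ => ∑ I : Finset (Fin a), (-1 : ℂ) ^ I.card *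
        (Complex.exp (-((∑ i ∈ I, (m i : ℂ)) * t)) * truncGeom (params n) 0 ∅ t) + 0 := by
      funext t; rw [add_zero]; exact expRatio_eq_sum t
    have hz : lapMellin (fun _ => 0) w y = 0 := by simp [lapMellin, mellin]
    rw [e, key.2, hz, add_zero, Finset.mul_sum]
    refine Finset.sum_congr rfl fun I _ => ?_
    have hx := notMem_poles_of_mem_slitPlane hω (Or.inl (hre I))
    rw [multHurwitz_eq_series hω hx hw, ← hurwitzExt_eq_series hω hK hα hw (by simpa using hre I),
      hurwitzExt, hα.lapCont_eq_mellin hw (by simpa using hre I), lapMellin_exp_mul]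
    simp
    ring
  · have h1 := (hα.mellinConvergent_and_eq 0 hw (hre I)).1
    refine IntegrableOn.congr_fun h1 (fun t _ => ?_) measurableSet_Ioi
    simp only [smul_eq_mul]
    rw [← mul_assoc (Complex.exp _) (Complex.exp _), ← Complex.exp_add]
    congr 3; ring

theorem image_exp_Ioi : Real.exp '' Ioi 0 = Ioi 1 := by
  ext x
  constructor
  · rintro ⟨t, ht, rfl⟩
    exact Real.one_lt_exp_iff.2 ht
  · intro (hx : 1 < x)
    exact ⟨Real.log x, Real.log_pos hx, Real.exp_log (by linarith)⟩

end Quotient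

/-! ### The absolute Hurwitz zeta function as a Laplace–Mellin integral -/

section AbsZetaQuotient

variable {a b : ℕ} {m : Fin a → ℕ} {n : Fin b → ℕ} {D : ℤ} {F : ℂ → OnePoint ℂ}

theorem absHurwitzIntegrand_exp (hn : ∀ j, 0 < n j)
    (hD : (D : ℂ) = ∑ i, (m i : ℂ) - ∑ j, (n j : ℂ))
    (hF : ∀ u : ℂ, ∏ j, (u ^ n j - 1) ≠ 0 →
      F u = (((∏ i, (u ^ m i - 1)) / ∏ j, (u ^ n j - 1) : ℂ) : OnePoint ℂ))
    (w s : ℂ) {t : ℝ} (ht : 0 < t) :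
    |Real.exp t| • absHurwitzIntegrand (fun x : ℝ => F x) w s (Real.exp t) =
      (t : ℂ) ^ (w - 1) • (Complex.exp (-((s - D) * t)) * expRatio m n t) := by
  have hpow : ∀ k : ℕ, (Real.exp t : ℂ) ^ k - 1 =
      Complex.exp (k * t) * (1 - Complex.exp (-((k : ℝ) * t))) := fun k => by
    rw [mul_sub, ← Complex.exp_add, Complex.ofReal_exp, ← Complex.exp_nat_mul]
    simp
  have hne : ∏ j, ((Real.exp t : ℂ) ^ n j - 1) ≠ 0 := by
    refine Finset.prod_ne_zero_iff.2 fun j _ => ?_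
    rw [hpow]
    exact mul_ne_zero (Complex.exp_ne_zero _)
      (one_sub_cexp_ne_zero (by exact_mod_cast hn j) ht)
  have hval : (∏ i, ((Real.exp t : ℂ) ^ m i - 1)) / ∏ j, ((Real.exp t : ℂ) ^ n j - 1) =
      Complex.exp (D * t) * expRatio m n t := by
    simp only [hpow, Finset.prod_mul_distrib, ← Complex.exp_sum, expRatio, Finset.prod_inv_distrib,
      ← Finset.sum_mul]
    rw [hD, sub_mul, Complex.exp_sub]
    field_simp
  have hexp : (Real.exp t : ℂ) ≠ 0 := by exact_mod_cast (Real.exp_pos t).ne'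
  rw [absHurwitzIntegrand, hF _ hne, hval, Real.log_exp, abs_of_pos (Real.exp_pos t),
    Complex.real_smul, smul_eq_mul, Complex.cpow_sub _ _ hexp, Complex.cpow_one,
    Complex.cpow_def_of_ne_zero hexp, ← Complex.ofReal_log (Real.exp_pos t).le, Real.log_exp]
  have e : Complex.exp (-((s - D) * t)) = Complex.exp (D * t) * Complex.exp (t * -s) := by
    rw [← Complex.exp_add]; congr 1; ring
  rw [e]
  change (Real.exp t : ℂ) * (Complex.exp (D * t) * expRatio m n t *
    (Complex.exp (t * -s) / (Real.exp t : ℂ)) * (t : ℂ) ^ (w - 1)) = _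
  field_simp

/-- The substitution `x = e^t` in the integral for `Z_f(w, s)`. -/
theorem absHurwitzIntegral_eq (hn : ∀ j, 0 < n j)
    (hD : (D : ℂ) = ∑ i, (m i : ℂ) - ∑ j, (n j : ℂ))
    (hF : ∀ u : ℂ, ∏ j, (u ^ n j - 1) ≠ 0 →
      F u = (((∏ i, (u ^ m i - 1)) / ∏ j, (u ^ n j - 1) : ℂ) : OnePoint ℂ)) (w s : ℂ) :
    (IntegrableOn (absHurwitzIntegrand (fun x : ℝ => F x) w s) (Ioi 1) ↔
      MellinConvergent (fun t : ℝ => Complex.exp (-((s - D) * t)) * expRatio m n t) w) ∧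
    absHurwitzIntegral (fun x : ℝ => F x) w s =
      (Complex.Gamma w)⁻¹ * lapMellin (expRatio m n) w (s - D) := by
  have hder : ∀ x ∈ Ioi (0 : ℝ), HasDerivWithinAt Real.exp (Real.exp x) (Ioi 0) x :=
    fun x _ => (Real.hasDerivAt_exp x).hasDerivWithinAt
  have hcongr : EqOn (fun t : ℝ => |Real.exp t| •
      absHurwitzIntegrand (fun x : ℝ => F x) w s (Real.exp t))
      (fun t : ℝ => (t : ℂ) ^ (w - 1) • (Complex.exp (-((s - D) * t)) * expRatio m n t))
      (Ioi 0) := fun t ht => absHurwitzIntegrand_exp hn hD hF w s ht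
  constructor
  · rw [← image_exp_Ioi, integrableOn_image_iff_integrableOn_abs_deriv_smul measurableSet_Ioi hder
      Real.exp_injective.injOn]
    exact integrableOn_congr_fun hcongr measurableSet_Ioi
  · rw [absHurwitzIntegral, one_div, ← image_exp_Ioi,
      integral_image_eq_integral_abs_deriv_smul measurableSet_Ioi hder Real.exp_injective.injOn,
      setIntegral_congr_fun measurableSet_Ioi hcongr]
    rfl

end AbsZetaQuotient

/-! ### Absolute zeta functions of quotients of products of `u^k - 1` -/

section ExplicitAbsZeta

variable {a b : ℕ} {m : Fin a → ℕ} {n : Fin b → ℕ} {D : ℤ} {F : ℂ → OnePoint ℂ}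

/-- `Z_f(w, s)` is the continuation of a Laplace–Mellin integral, with poles in `{1, …, b - a}`
at most. -/
theorem absHurwitz_spec (hn : ∀ j, 0 < n j)
    (hD : (D : ℂ) = ∑ i, (m i : ℂ) - ∑ j, (n j : ℂ))
    (hF : ∀ u : ℂ, ∏ j, (u ^ n j - 1) ≠ 0 →
      F u = (((∏ i, (u ^ m i - 1)) / ∏ j, (u ^ n j - 1) : ℂ) : OnePoint ℂ))
    {α : ℕ → ℂ} (hα : HasLaurentBound (expRatio m n) (b - a) α) {s : ℂ} (hs : (D : ℝ) < s.re) :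
    IsMeroContinuation (fun w => absHurwitzIntegral (fun x : ℝ => F x) w s)
      (fun w => absHurwitz (fun x : ℝ => F x) w s) ∧
    ∀ w : ℂ, (∀ j ∈ Finset.Icc 1 (b - a), w ≠ (j : ℂ)) →
      (fun w => absHurwitz (fun x : ℝ => F x) w s) =ᶠ[𝓝 w]
        fun w => lapCont (expRatio m n) (b - a) α w (s - D) := by
  have hy : 0 < (s - D).re := by simpa using hs
  have h := meroContinuation_spec (F := fun w => absHurwitzIntegral (fun x : ℝ => F x) w s)
    (G := fun w => lapCont (expRatio m n) (b - a) α w (s - D))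
    (fun w _ => hα.meromorphicAt_lapCont w hy) ((b - a : ℕ) : ℝ)
    (fun w hw => hα.analyticAt_lapCont hy (ne_natCast_of_lt_re hw))
    (fun w hw => by
      rw [(absHurwitzIntegral_eq hn hD hF w s).2, hα.lapCont_eq_mellin hw hy])
  exact ⟨h.1, fun w hw => h.2 w (hα.analyticAt_lapCont hy hw)⟩

theorem params_pos (hn : ∀ j, 0 < n j) (j : Fin b) : 0 < params n j := by
  simpa [params] using hn j

theorem arg_mem_slitPlane {s : ℂ} (hs : s - D ∈ Complex.slitPlane) (I : Finset (Fin a)) :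
    arg D m s I ∈ Complex.slitPlane := by
  have h0 : (0 : ℝ) ≤ ∑ i ∈ I, (m i : ℝ) := Finset.sum_nonneg fun _ _ => Nat.cast_nonneg _
  have e : ∑ i ∈ I, (m i : ℂ) = ((∑ i ∈ I, (m i : ℝ) : ℝ) : ℂ) := by push_cast; rfl
  rw [arg, e]
  rcases hs with h | h
  · left; rw [Complex.add_re, Complex.ofReal_re]; linarith
  · right; rwa [Complex.add_im, Complex.ofReal_im, add_zero]

theorem arg_notMem_poles (hn : ∀ j, 0 < n j) {s : ℂ} (hs : s - D ∈ Complex.slitPlane)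
    (I : Finset (Fin a)) : arg D m s I ∉ multGammaPoles (params n) :=
  notMem_poles_of_mem_slitPlane (params_pos hn) (arg_mem_slitPlane hs I)

theorem sub_mem_slitPlane {s : ℂ} (hs : (D : ℝ) < s.re) : s - D ∈ Complex.slitPlane :=
  Or.inl (by simpa using hs)

theorem analyticAt_altHurwitzSum (hn : ∀ j, 0 < n j) {w s : ℂ}
    (hw : ∀ j ∈ Finset.Icc 1 b, w ≠ (j : ℂ)) (hs : (D : ℝ) < s.re) :
    AnalyticAt ℂ (fun w => altHurwitzSum m n D w s) w :=
  Finset.analyticAt_fun_sum _ fun I _ => analyticAt_const.fun_mul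
    (analyticAt_multHurwitz (params_pos hn) (arg_notMem_poles hn (sub_mem_slitPlane hs) I) hw)

/-- Both sides are analytic in `w` outside `{1, …, b}` and agree for `Re w > b`, where the
binomial expansion of the numerator may be integrated term by term. -/
theorem absHurwitz_eq_altHurwitzSum (hn : ∀ j, 0 < n j) (hab : a ≤ b)
    (hD : (D : ℂ) = ∑ i, (m i : ℂ) - ∑ j, (n j : ℂ))
    (hF : ∀ u : ℂ, ∏ j, (u ^ n j - 1) ≠ 0 →
      F u = (((∏ i, (u ^ m i - 1)) / ∏ j, (u ^ n j - 1) : ℂ) : OnePoint ℂ))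
    {w s : ℂ} (hw : ∀ j ∈ Finset.Icc 1 b, w ≠ (j : ℂ)) (hs : (D : ℝ) < s.re) :
    absHurwitz (fun x : ℝ => F x) w s = altHurwitzSum m n D w s := by
  obtain ⟨α, hα, -⟩ := exists_hasLaurentBound_expRatio (m := m) hn hab
  have hspec := (absHurwitz_spec hn hD hF hα hs).2
  have hy : 0 < (s - D).re := by simpa using hs
  have hmem : ∀ z : ℂ, z ∉ (((Finset.Icc 1 b).image fun j : ℕ => (j : ℂ) : Finset ℂ) : Set ℂ) ↔
      ∀ j ∈ Finset.Icc 1 b, z ≠ (j : ℂ) := fun z => by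
    simp only [Finset.coe_image, Set.mem_image, Finset.mem_coe, not_exists, not_and]
    exact ⟨fun h j hj e => h j hj e.symm, fun h j hj e => h j hj e.symm⟩
  refine eq_of_analyticAt_of_eq_halfPlane (F := fun w => absHurwitz (fun x : ℝ => F x) w s)
    (G := fun w => altHurwitzSum m n D w s)
    ((Finset.Icc 1 b).image fun j : ℕ => (j : ℂ)).finite_toSet b ?_ ?_ ?_ ((hmem w).2 hw)
  · intro z hz
    have hz' := ne_natCast_mono (Nat.sub_le b a) ((hmem z).1 hz)
    exact (hα.analyticAt_lapCont hy hz').congr (hspec z hz').symm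
  · exact fun z hz => analyticAt_altHurwitzSum hn ((hmem z).1 hz) hs
  · intro z hz
    have hz' := ne_natCast_mono (Nat.sub_le b a) (ne_natCast_of_lt_re hz)
    have hz2 : ((b - a : ℕ) : ℝ) < z.re :=
      lt_of_le_of_lt (by exact_mod_cast Nat.sub_le b a) hz
    rw [(hspec z hz').eq_of_nhds, hα.lapCont_eq_mellin hz2 hy, lapMellin_expRatio hn hz hy]
    rfl

/-- The product of multiple gamma functions that computes the absolute zeta function. -/
def gammaProd (m : Fin a → ℕ) (n : Fin b → ℕ) (D : ℤ) (s : ℂ) : ℂ :=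
  ∏ I : Finset (Fin a), (multGamma (arg D m s I) (params n)) ^ ((-1 : ℤ) ^ I.card)

/-- Differentiation at `w = 0` turns the alternating sum of multiple Hurwitz zeta functions into
a product of multiple gamma functions. -/
theorem absZetaHalfPlane_eq (hn : ∀ j, 0 < n j) (hab : a ≤ b)
    (hD : (D : ℂ) = ∑ i, (m i : ℂ) - ∑ j, (n j : ℂ))
    (hF : ∀ u : ℂ, ∏ j, (u ^ n j - 1) ≠ 0 →
      F u = (((∏ i, (u ^ m i - 1)) / ∏ j, (u ^ n j - 1) : ℂ) : OnePoint ℂ))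
    {s : ℂ} (hs : (D : ℝ) < s.re) :
    gammaProd m n D s = absZetaHalfPlane (fun x : ℝ => F x) s := by
  have he : (fun w => absHurwitz (fun x : ℝ => F x) w s) =ᶠ[𝓝 0]
      fun w => altHurwitzSum m n D w s := by
    have : ∀ᶠ w : ℂ in 𝓝 0, ∀ j ∈ Finset.Icc 1 b, w ≠ (j : ℂ) :=
      (Filter.eventually_all_finset _).2 fun j hj =>
        isOpen_ne.mem_nhds (zero_ne_natCast b j hj)
    filter_upwards [this] with w hw
    exact absHurwitz_eq_altHurwitzSum hn hab hD hF hw hs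
  have hd : ∀ I : Finset (Fin a), DifferentiableAt ℂ
      (fun w => multHurwitz w (arg D m s I) (params n)) 0 := fun I =>
    (analyticAt_multHurwitz (params_pos hn) (arg_notMem_poles hn (sub_mem_slitPlane hs) I)
      (zero_ne_natCast b)).differentiableAt
  rw [absZetaHalfPlane, he.deriv_eq]
  simp only [altHurwitzSum]
  rw [deriv_fun_sum fun I _ => (hd I).const_mul _, Complex.exp_sum, gammaProd]
  refine Finset.prod_congr rfl fun I _ => ?_
  rw [deriv_const_mul _ (hd I), multGamma, ← Complex.exp_int_mul]
  push_cast
  rfl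

theorem analyticAt_arg (s : ℂ) (I : Finset (Fin a)) : AnalyticAt ℂ (fun s => arg D m s I) s := by
  unfold arg; fun_prop

theorem meromorphicAt_gammaProd (hn : ∀ j, 0 < n j) (s : ℂ) :
    MeromorphicAt (gammaProd m n D) s ∧
      ((∀ I : Finset (Fin a), arg D m s I ∉ multGammaPoles (params n)) →
        AnalyticAt ℂ (gammaProd m n D) s) := by
  constructor
  · refine MeromorphicAt.fun_prod fun I _ => MeromorphicAt.fun_zpow ?_ _
    exact (meromorphicAt_multGamma (params_pos hn) _).1.comp_analyticAt (analyticAt_arg s I)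
  · intro h
    refine Finset.analyticAt_fun_prod _ fun I _ => AnalyticAt.fun_zpow ?_ (multGamma_ne_zero _)
    exact AnalyticAt.comp (g := fun x => multGamma x (params n)) (f := fun s => arg D m s I)
      ((meromorphicAt_multGamma (params_pos hn) _).2 (h I)) (analyticAt_arg s I)

theorem absZeta_spec (hn : ∀ j, 0 < n j) (hab : a ≤ b)
    (hD : (D : ℂ) = ∑ i, (m i : ℂ) - ∑ j, (n j : ℂ))
    (hF : ∀ u : ℂ, ∏ j, (u ^ n j - 1) ≠ 0 →
      F u = (((∏ i, (u ^ m i - 1)) / ∏ j, (u ^ n j - 1) : ℂ) : OnePoint ℂ)) :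
    IsMeroContinuation (absZetaHalfPlane (fun x : ℝ => F x)) (absZeta (fun x : ℝ => F x)) ∧
      ∀ s : ℂ, (∀ I : Finset (Fin a), arg D m s I ∉ multGammaPoles (params n)) →
        absZeta (fun x : ℝ => F x) s = gammaProd m n D s := by
  have h := meroContinuation_spec (F := absZetaHalfPlane (fun x : ℝ => F x))
    (G := gammaProd m n D) (fun s _ => (meromorphicAt_gammaProd hn s).1) D
    (fun s hs => (meromorphicAt_gammaProd hn s).2 fun I =>
      arg_notMem_poles hn (sub_mem_slitPlane hs) I)
    (fun s hs => absZetaHalfPlane_eq hn hab hD hF hs)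
  exact ⟨h.1, fun s hs => (h.2 s ((meromorphicAt_gammaProd hn s).2 hs)).eq_of_nhds⟩

/-- The substitution `s ↦ D - s` exchanges `I` and its complement, up to the reflection
`x ↦ n(1) + ⋯ + n(b) - x` that defines the multiple sine function. -/
theorem sum_sub_arg (hD : (D : ℂ) = ∑ i, (m i : ℂ) - ∑ j, (n j : ℂ)) (s : ℂ)
    (I : Finset (Fin a)) :
    (∑ j, (params n j : ℂ)) - arg D m s I = arg D m (D - s) Iᶜ := by
  have h := Finset.sum_add_sum_compl I fun i => (m i : ℂ)
  simp only [arg, params, Complex.ofReal_natCast]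
  linear_combination hD - h

/-- The functional equation: all factors `Γ_b(s - D + m(I))` cancel, and the signs of the remaining
ones match because `a + b` is even. -/
theorem gammaProd_reflect (hD : (D : ℂ) = ∑ i, (m i : ℂ) - ∑ j, (n j : ℂ))
    (hpar : Even (a + b)) (s : ℂ) :
    gammaProd m n D (D - s) =
      (∏ I : Finset (Fin a), (multSine (arg D m s I) (params n)) ^ ((-1 : ℤ) ^ I.card)) *
        gammaProd m n D s := by
  rw [gammaProd, gammaProd, ← Finset.prod_mul_distrib,
    ← Equiv.prod_comp (compl_involutive.toPerm (compl : Finset (Fin a) → Finset (Fin a)))]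
  refine Finset.prod_congr rfl fun I _ => ?_
  have hI : I.card ≤ a := by simpa using Finset.card_le_univ I
  rw [← mul_zpow, multSine, sum_sub_arg hD, mul_right_comm,
    inv_mul_cancel₀ (multGamma_ne_zero _), one_mul, ← zpow_mul, ← pow_add]
  change multGamma (arg D m (D - s) Iᶜ) (params n) ^ ((-1 : ℤ) ^ Iᶜ.card) = _
  congr 1
  rw [Finset.card_compl, Fintype.card_fin]
  refine (neg_one_pow_congr ?_)
  rw [Nat.even_sub hI, Nat.even_add]
  rw [Nat.even_add] at hpar
  tauto

/-- All assertions follow from the quotient formula, automorphy, and three numerical facts: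
`a ≤ b`, `D = ∑ m(i) - ∑ n(j)` and the parity of `a + b`. -/
theorem explicitAbsZeta_of_quotient (hn : ∀ j, 0 < n j) (hab : a ≤ b) (hpar : Even (a + b))
    (hD : (D : ℂ) = ∑ i, (m i : ℂ) - ∑ j, (n j : ℂ))
    (hF : ∀ u : ℂ, ∏ j, (u ^ n j - 1) ≠ 0 →
      F u = (((∏ i, (u ^ m i - 1)) / ∏ j, (u ^ n j - 1) : ℂ) : OnePoint ℂ))
    (hauto : IsAbsAutomorphic (fun x : ℝ => F x) D) : ExplicitAbsZeta F m n D := by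
  obtain ⟨α, hα, -⟩ := exists_hasLaurentBound_expRatio (m := m) hn hab
  have hspec := absZeta_spec hn hab hD hF
  refine ⟨hF, hauto, multHurwitzWellDefined (params_pos hn), fun w s hw hs => ?_, fun s hs => ?_,
    fun w s hw hs => absHurwitz_eq_altHurwitzSum hn hab hD hF hw hs, fun w hw s hs => ?_,
    ⟨hspec.1, fun s hs => ?_⟩, hspec.2, fun s hs => ?_⟩
  · have hw' : ((b - a : ℕ) : ℝ) < w.re := by rwa [Nat.cast_sub hab]
    have hy : 0 < (s - D).re := by simpa using hs
    obtain ⟨h1, h2⟩ := absHurwitzIntegral_eq hn hD hF w s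
    refine ⟨h1.2 (hα.mellinConvergent_and_eq 0 hw' hy).1, ?_⟩
    rw [((absHurwitz_spec hn hD hF hα hs).2 w (ne_natCast_of_lt_re hw')).eq_of_nhds, h2,
      hα.lapCont_eq_mellin hw' hy]
  · have hy : 0 < (s - D).re := by simpa using hs
    obtain ⟨h1, h2⟩ := absHurwitz_spec hn hD hF hα hs
    exact ⟨h1, (hα.analyticAt_lapCont hy (zero_ne_natCast _)).congr
      (h2 0 (zero_ne_natCast _)).symm⟩
  · refine DifferentiableAt.differentiableWithinAt (DifferentiableAt.fun_sum fun I _ => ?_)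
    exact ((differentiableAt_multHurwitz_right (params_pos hn) hw
      (arg_mem_slitPlane hs I)).comp s (analyticAt_arg s I).differentiableAt).const_mul _
  · rw [hspec.2 s fun I => arg_notMem_poles hn (sub_mem_slitPlane hs) I,
      absZetaHalfPlane_eq hn hab hD hF hs]
  · have h2 : ∀ I : Finset (Fin a), arg D m (D - s) I ∉ multGammaPoles (params n) := fun I => by
      have := (hs Iᶜ).2
      rwa [sum_sub_arg hD, compl_compl] at this
    rw [hspec.2 _ h2, hspec.2 s fun I => (hs I).1, gammaProd_reflect hD hpar]

end ExplicitAbsZeta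

/-! ### Fourier decomposition of the walks -/

section Walk

variable {N : ℕ} [NeZero N]

/-- The Fourier matrix of `ℤ/N`. -/
def fourierMatrix (N : ℕ) [NeZero N] : Matrix (ZMod N) (ZMod N) ℂ :=
  Matrix.of fun k x => ZMod.stdAddChar (k * x)

theorem det_fourierMatrix_ne_zero : (fourierMatrix N).det ≠ 0 := by
  have h : fourierMatrix N * Matrix.of (fun x k => ZMod.stdAddChar (-(x * k))) =
      (N : ℂ) • (1 : Matrix (ZMod N) (ZMod N) ℂ) := by
    ext k l
    rw [Matrix.mul_apply, Matrix.smul_apply, Matrix.one_apply]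
    have e : ∀ x : ZMod N, fourierMatrix N k x * Matrix.of (fun x k : ZMod N =>
        (ZMod.stdAddChar (-(x * k)) : ℂ)) x l = ZMod.stdAddChar (x * (k - l)) := fun x => by
      simp only [fourierMatrix, Matrix.of_apply]
      rw [← AddChar.map_add_eq_mul]
      congr 1; ring
    rw [Finset.sum_congr rfl fun x _ => e x,
      AddChar.sum_mulShift _ (ZMod.isPrimitive_stdAddChar N), ZMod.card]
    by_cases hkl : k = l
    · simp [hkl]
    · simp [hkl, sub_eq_zero]
  intro h0
  have h1 := congrArg Matrix.det h
  rw [Matrix.det_mul, h0, zero_mul, Matrix.det_smul, Matrix.det_one, mul_one] at h1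
  exact pow_ne_zero _ (Nat.cast_ne_zero.2 (NeZero.ne N)) h1.symm

/-- The Fourier transform decomposes a translation-invariant walk into `2 × 2` blocks. -/
theorem det_one_sub_evolution (A : Matrix (Fin 2) (Fin 2) ℂ) (u : ℂ) :
    (1 - u • evolution N A).det = ∏ k : ZMod N,
      (1 - u * (ZMod.stdAddChar (-k) * A 0 0 + ZMod.stdAddChar k * A 1 1) + u ^ 2 * A.det) := by
  set Φ : Matrix (ZMod N × Fin 2) (ZMod N × Fin 2) ℂ :=
    fourierMatrix N ⊗ₖ (1 : Matrix (Fin 2) (Fin 2) ℂ) with hΦ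
  set d : ZMod N × Fin 2 → ℂ := fun p => ZMod.stdAddChar (p.1 * step N p.2) with hd
  have hdet : Φ.det ≠ 0 := by
    rw [hΦ, Matrix.det_kronecker]
    simpa using det_fourierMatrix_ne_zero
  have hS : Φ * shiftOp N = Matrix.diagonal d * Φ := by
    ext ⟨k, i⟩ ⟨x, j⟩
    rw [Matrix.mul_apply, Matrix.diagonal_mul, Finset.sum_eq_single (x + step N j, j)]
    · simp only [hΦ, hd, shiftOp, fourierMatrix, Matrix.kroneckerMap_apply, Matrix.of_apply,
        Matrix.one_apply]
      by_cases hij : i = j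
      · subst hij
        simp [mul_add, AddChar.map_add_eq_mul, mul_comm]
      · simp [hij]
    · rintro ⟨y, l⟩ - hne
      simp only [shiftOp, Matrix.of_apply]
      rw [if_neg, mul_zero]
      rintro ⟨rfl, rfl⟩
      exact hne rfl
    · simp
  have hC : Φ * coinOp N A = coinOp N A * Φ := by
    rw [hΦ, coinOp, ← Matrix.mul_kronecker_mul, ← Matrix.mul_kronecker_mul]
    simp
  have hconj : Φ * (1 - u • evolution N A) =
      (1 - u • (Matrix.diagonal d * coinOp N A)) * Φ := by
    rw [mul_sub, sub_mul, Matrix.mul_smul, Matrix.smul_mul, evolution, ← mul_assoc, hS,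
      mul_assoc, hC, mul_assoc, mul_one, one_mul]
  have h1 := congrArg Matrix.det hconj
  rw [Matrix.det_mul, Matrix.det_mul, mul_comm] at h1
  rw [mul_right_cancel₀ hdet h1]
  have hblock : 1 - u • (Matrix.diagonal d * coinOp N A) =
      (Matrix.blockDiagonal fun k : ZMod N =>
        1 - u • (Matrix.diagonal (fun i => d (k, i)) * A)).submatrix
        (Equiv.prodComm _ _) (Equiv.prodComm _ _) := by
    ext ⟨k, i⟩ ⟨l, j⟩
    by_cases hkl : k = l
    · subst hkl
      simp [Matrix.blockDiagonal_apply, coinOp, Matrix.one_apply, Matrix.kroneckerMap_apply]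
    · simp [Matrix.blockDiagonal_apply, coinOp, Matrix.kroneckerMap_apply, hkl]
  rw [hblock, Matrix.det_submatrix_equiv_self, Matrix.det_blockDiagonal]
  refine Finset.prod_congr rfl fun k _ => ?_
  have hinv : (ZMod.stdAddChar (-k) : ℂ) * ZMod.stdAddChar k = 1 := by
    rw [← AddChar.map_add_eq_mul]; simp
  rw [Matrix.det_fin_two, Matrix.det_fin_two]
  simp [hd, step, Matrix.diagonal_mul]
  linear_combination (u ^ 2 * (A 0 0 * A 1 1 - A 0 1 * A 1 0)) * hinv

theorem stdAddChar_eq_pow (k : ZMod N) :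
    (ZMod.stdAddChar k : ℂ) = Complex.exp (2 * Real.pi * Complex.I / N) ^ k.val := by
  have h := ZMod.stdAddChar_coe (N := N) (k.val : ℤ)
  rw [Int.cast_natCast, ZMod.natCast_zmod_val] at h
  rw [h, ← Complex.exp_nat_mul]
  congr 1; push_cast; ring

end Walk

/-! ### The characteristic polynomials for cycles of length 2, 4, 8 -/

section Determinants

theorem inv_sqrt_two_sq : (1 / (Real.sqrt 2 : ℂ)) ^ 2 = 1 / 2 := by
  rw [div_pow, one_pow, ← Complex.ofReal_pow, Real.sq_sqrt (by norm_num)]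
  norm_num

theorem det_one_sub_evolution_coinM (N : ℕ) [NeZero N] (u : ℂ) :
    (1 - u • evolution N coinM).det = ∏ k : ZMod N, (1 - u ^ 2 - u * (1 / (Real.sqrt 2 : ℂ)) *
      (ZMod.stdAddChar (-k) - ZMod.stdAddChar k)) := by
  rw [det_one_sub_evolution]
  refine Finset.prod_congr rfl fun k _ => ?_
  have h := inv_sqrt_two_sq
  rw [coinM, Matrix.det_fin_two]
  simp only [Matrix.smul_apply, smul_eq_mul, Matrix.of_apply, Matrix.cons_val',
    Matrix.cons_val_zero, Matrix.cons_val_one, Matrix.cons_val_fin_one]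
  linear_combination (-2 * u ^ 2) * h

theorem det_one_sub_evolution_coinF (N : ℕ) [NeZero N] (u : ℂ) :
    (1 - u • evolution N coinF).det = ∏ k : ZMod N, (1 + u ^ 2 - u * (1 / (Real.sqrt 2 : ℂ)) *
      (ZMod.stdAddChar (-k) + ZMod.stdAddChar k)) := by
  rw [det_one_sub_evolution]
  refine Finset.prod_congr rfl fun k _ => ?_
  have h := inv_sqrt_two_sq
  rw [coinF, Matrix.det_fin_two]
  simp only [Matrix.smul_apply, smul_eq_mul, Matrix.of_apply, Matrix.cons_val',
    Matrix.cons_val_zero, Matrix.cons_val_one, Matrix.cons_val_fin_one]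
  linear_combination (2 * u ^ 2) * h

theorem rootOfUnity_two : Complex.exp (2 * Real.pi * Complex.I / (2 : ℕ)) = -1 := by
  rw [← Complex.exp_pi_mul_I]
  congr 1; push_cast; ring

theorem rootOfUnity_four : Complex.exp (2 * Real.pi * Complex.I / (4 : ℕ)) = Complex.I := by
  rw [show 2 * Real.pi * Complex.I / (4 : ℕ) = (Real.pi / 2 : ℂ) * Complex.I by push_cast; ring,
    Complex.exp_mul_I, Complex.cos_pi_div_two, Complex.sin_pi_div_two]
  simp

theorem rootOfUnity_eight : Complex.exp (2 * Real.pi * Complex.I / (8 : ℕ)) =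
    1 / (Real.sqrt 2 : ℂ) * (1 + Complex.I) := by
  have h2 : (Real.sqrt 2 : ℂ) ≠ 0 := by
    exact_mod_cast (Real.sqrt_pos.2 (by norm_num : (0 : ℝ) < 2)).ne'
  have h3 : (Real.sqrt 2 : ℂ) ^ 2 = 2 := by
    rw [← Complex.ofReal_pow, Real.sq_sqrt (by norm_num)]; norm_num
  rw [show 2 * Real.pi * Complex.I / (8 : ℕ) = ((Real.pi / 4 : ℝ) : ℂ) * Complex.I by
      push_cast; ring,
    Complex.exp_mul_I, ← Complex.ofReal_cos, ← Complex.ofReal_sin, Real.cos_pi_div_four,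
    Real.sin_pi_div_four]
  push_cast
  field_simp
  linear_combination (1 + Complex.I) * h3

theorem det_walkM_two (u : ℂ) : (1 - u • evolution 2 coinM).det = (1 - u ^ 2) ^ 2 := by
  rw [det_one_sub_evolution_coinM]
  simp only [stdAddChar_eq_pow, rootOfUnity_two]
  refine (Fin.prod_univ_two _).trans ?_
  change (1 - u ^ 2 - _ * ((-1) ^ 0 - (-1) ^ 0)) * (1 - u ^ 2 - _ * ((-1) ^ 1 - (-1) ^ 1)) = _
  ring

theorem det_walkF_two (u : ℂ) : (1 - u • evolution 2 coinF).det = 1 + u ^ 4 := by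
  rw [det_one_sub_evolution_coinF]
  simp only [stdAddChar_eq_pow, rootOfUnity_two]
  have h := inv_sqrt_two_sq
  generalize 1 / (Real.sqrt 2 : ℂ) = q at *
  refine (Fin.prod_univ_two _).trans ?_
  change (1 + u ^ 2 - u * q * ((-1) ^ 0 + (-1) ^ 0)) *
    (1 + u ^ 2 - u * q * ((-1) ^ 1 + (-1) ^ 1)) = _
  linear_combination (-4 * u ^ 2) * h

theorem det_walkM_four (u : ℂ) :
    (1 - u • evolution 4 coinM).det = (1 - u ^ 2) ^ 2 * (1 + u ^ 4) := by
  rw [det_one_sub_evolution_coinM]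
  simp only [stdAddChar_eq_pow, rootOfUnity_four]
  have h := inv_sqrt_two_sq
  generalize 1 / (Real.sqrt 2 : ℂ) = q at *
  have hI := Complex.I_sq
  refine (Fin.prod_univ_four _).trans ?_
  generalize Complex.I = z at *
  change (1 - u ^ 2 - u * q * (z ^ 0 - z ^ 0)) * (1 - u ^ 2 - u * q * (z ^ 3 - z ^ 1)) *
    (1 - u ^ 2 - u * q * (z ^ 2 - z ^ 2)) * (1 - u ^ 2 - u * q * (z ^ 1 - z ^ 3)) = _
  have h3 : z ^ 3 = -z := by linear_combination z * hI
  rw [h3]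
  linear_combination (1 - u ^ 2) ^ 2 * (4 * u ^ 2 * h - 4 * q ^ 2 * u ^ 2 * hI)

theorem det_walkF_four (u : ℂ) :
    (1 - u • evolution 4 coinF).det = (1 + u ^ 4) * (1 + u ^ 2) ^ 2 := by
  rw [det_one_sub_evolution_coinF]
  simp only [stdAddChar_eq_pow, rootOfUnity_four]
  have h := inv_sqrt_two_sq
  generalize 1 / (Real.sqrt 2 : ℂ) = q at *
  have hI := Complex.I_sq
  refine (Fin.prod_univ_four _).trans ?_
  generalize Complex.I = z at *
  change (1 + u ^ 2 - u * q * (z ^ 0 + z ^ 0)) * (1 + u ^ 2 - u * q * (z ^ 3 + z ^ 1)) *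
    (1 + u ^ 2 - u * q * (z ^ 2 + z ^ 2)) * (1 + u ^ 2 - u * q * (z ^ 1 + z ^ 3)) = _
  have h3 : z ^ 3 = -z := by linear_combination z * hI
  rw [h3, hI]
  linear_combination (1 + u ^ 2) ^ 2 * (-4 * u ^ 2 * h)

/-- The powers of the primitive eighth root of unity `q (1 + i)`, `q = 1 / √2`. -/
theorem pow_eighth_root {q z : ℂ} (h : q ^ 2 = 1 / 2) (hI : z ^ 2 = -1) :
    (q * (1 + z)) ^ 2 = z ∧ (q * (1 + z)) ^ 3 = q * (z - 1) ∧ (q * (1 + z)) ^ 4 = -1 ∧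
      (q * (1 + z)) ^ 5 = -(q * (1 + z)) ∧ (q * (1 + z)) ^ 6 = -z ∧
      (q * (1 + z)) ^ 7 = q * (1 - z) := by
  have h2 : (q * (1 + z)) ^ 2 = z := by linear_combination (1 + z) ^ 2 * h + 1 / 2 * hI
  have h4 : (q * (1 + z)) ^ 4 = -1 := by
    rw [show 4 = 2 * 2 from rfl, pow_mul, h2, hI]
  refine ⟨h2, ?_, h4, ?_, ?_, ?_⟩
  · rw [pow_succ, h2]; linear_combination q * hI
  · rw [pow_succ, h4]; ring
  · rw [show 6 = 4 + 2 from rfl, pow_add, h4, h2]; ring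
  · rw [show 7 = 4 + 2 + 1 from rfl, pow_succ, pow_add, h4, h2]; linear_combination -q * hI

theorem det_walkM_eight (u : ℂ) : (1 - u • evolution 8 coinM).det =
    (1 - u ^ 2) ^ 2 * (1 - u ^ 2 + u ^ 4) ^ 2 * (1 + u ^ 4) := by
  rw [det_one_sub_evolution_coinM]
  simp only [stdAddChar_eq_pow, rootOfUnity_eight]
  have h := inv_sqrt_two_sq
  generalize 1 / (Real.sqrt 2 : ℂ) = q at *
  have hI := Complex.I_sq
  refine (Fin.prod_univ_eight _).trans ?_
  generalize Complex.I = z at *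
  obtain ⟨h2, h3, h4, h5, h6, h7⟩ := pow_eighth_root h hI
  set y := q * (1 + z) with hy
  -- the factors for `k` and `4 - k` agree; those for `k` and `-k` differ in the sign of `z`
  change (1 - u ^ 2 - u * q * (y ^ 0 - y ^ 0)) * (1 - u ^ 2 - u * q * (y ^ 7 - y ^ 1)) *
    (1 - u ^ 2 - u * q * (y ^ 6 - y ^ 2)) * (1 - u ^ 2 - u * q * (y ^ 5 - y ^ 3)) *
    (1 - u ^ 2 - u * q * (y ^ 4 - y ^ 4)) * (1 - u ^ 2 - u * q * (y ^ 3 - y ^ 5)) *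
    (1 - u ^ 2 - u * q * (y ^ 2 - y ^ 6)) * (1 - u ^ 2 - u * q * (y ^ 1 - y ^ 7)) = _
  rw [h2, h3, h4, h5, h6, h7, pow_one, hy]
  have f1 : 1 - u ^ 2 - u * q * (q * (1 - z) - q * (1 + z)) = 1 - u ^ 2 + u * z := by
    linear_combination 2 * u * z * h
  have f3 : 1 - u ^ 2 - u * q * (-(q * (1 + z)) - q * (z - 1)) = 1 - u ^ 2 + u * z := by
    linear_combination 2 * u * z * h
  have f5 : 1 - u ^ 2 - u * q * (q * (z - 1) - -(q * (1 + z))) = 1 - u ^ 2 - u * z := by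
    linear_combination -2 * u * z * h
  have f7 : 1 - u ^ 2 - u * q * (q * (1 + z) - q * (1 - z)) = 1 - u ^ 2 - u * z := by
    linear_combination -2 * u * z * h
  have g1 : (1 - u ^ 2 + u * z) * (1 - u ^ 2 - u * z) = 1 - u ^ 2 + u ^ 4 := by
    linear_combination -u ^ 2 * hI
  have g2 : (1 - u ^ 2 - u * q * (-z - z)) * (1 - u ^ 2 - u * q * (z - -z)) = 1 + u ^ 4 := by
    linear_combination 4 * u ^ 2 * h - 4 * q ^ 2 * u ^ 2 * hI
  rw [f1, f3, f5, f7, ← g1, ← g2]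
  ring

theorem det_walkF_eight (u : ℂ) : (1 - u • evolution 8 coinF).det =
    (1 + u ^ 4) * (1 + u ^ 2 + u ^ 4) ^ 2 * (1 + u ^ 2) ^ 2 := by
  rw [det_one_sub_evolution_coinF]
  simp only [stdAddChar_eq_pow, rootOfUnity_eight]
  have h := inv_sqrt_two_sq
  generalize 1 / (Real.sqrt 2 : ℂ) = q at *
  have hI := Complex.I_sq
  refine (Fin.prod_univ_eight _).trans ?_
  generalize Complex.I = z at *
  obtain ⟨h2, h3, h4, h5, h6, h7⟩ := pow_eighth_root h hI
  set y := q * (1 + z) with hy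
  -- the factors for `k` and `-k` agree; those for `k` and `4 - k` differ in the sign of `u`
  change (1 + u ^ 2 - u * q * (y ^ 0 + y ^ 0)) * (1 + u ^ 2 - u * q * (y ^ 7 + y ^ 1)) *
    (1 + u ^ 2 - u * q * (y ^ 6 + y ^ 2)) * (1 + u ^ 2 - u * q * (y ^ 5 + y ^ 3)) *
    (1 + u ^ 2 - u * q * (y ^ 4 + y ^ 4)) * (1 + u ^ 2 - u * q * (y ^ 3 + y ^ 5)) *
    (1 + u ^ 2 - u * q * (y ^ 2 + y ^ 6)) * (1 + u ^ 2 - u * q * (y ^ 1 + y ^ 7)) = _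
  rw [h2, h3, h4, h5, h6, h7, pow_one, hy]
  have f1 : 1 + u ^ 2 - u * q * (q * (1 - z) + q * (1 + z)) = 1 + u ^ 2 - u := by
    linear_combination -2 * u * h
  have f3 : 1 + u ^ 2 - u * q * (-(q * (1 + z)) + q * (z - 1)) = 1 + u ^ 2 + u := by
    linear_combination 2 * u * h
  have f5 : 1 + u ^ 2 - u * q * (q * (z - 1) + -(q * (1 + z))) = 1 + u ^ 2 + u := by
    linear_combination 2 * u * h
  have f7 : 1 + u ^ 2 - u * q * (q * (1 + z) + q * (1 - z)) = 1 + u ^ 2 - u := by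
    linear_combination -2 * u * h
  have g2 : (1 + u ^ 2 - u * q * (y ^ 0 + y ^ 0)) * (1 + u ^ 2 - u * q * (-1 + -1)) =
      1 + u ^ 4 := by
    linear_combination -4 * u ^ 2 * h
  rw [f1, f3, f5, f7, ← g2]
  ring

end Determinants

/-! ### The zeta functions of the walks -/

section WalkZeta

variable {N : ℕ} [NeZero N] {A : Matrix (Fin 2) (Fin 2) ℂ} {a b : ℕ} {m : Fin a → ℕ}
  {n : Fin b → ℕ} {p : ℂ → ℂ}

theorem walkZeta_eq_quotient (hp : ∀ u, (1 - u • evolution N A).det = p u)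
    (hpq : ∀ u, p u * ∏ i, (u ^ m i - 1) = ∏ j, (u ^ n j - 1)) (u : ℂ)
    (hu : ∏ j, (u ^ n j - 1) ≠ 0) :
    walkZeta N A u = (((∏ i, (u ^ m i - 1)) / ∏ j, (u ^ n j - 1) : ℂ) : OnePoint ℂ) := by
  rw [← hpq] at hu ⊢
  have h1 := left_ne_zero_of_mul hu
  have h2 := right_ne_zero_of_mul hu
  rw [walkZeta, hp, if_neg h1]
  congr 1
  field_simp

/-- A reciprocal characteristic polynomial `p` of degree `d` gives an absolute automorphic form of
weight `-d`. At a zero of `p(1/x)` both sides are `∞`. -/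
theorem isAbsAutomorphic_walkZeta (hp : ∀ u, (1 - u • evolution N A).det = p u) {d : ℕ}
    (hrec : ∀ x : ℂ, x ≠ 0 → x ^ d * p (1 / x) = p x) :
    IsAbsAutomorphic (fun x : ℝ => walkZeta N A x) (-(d : ℤ)) := by
  refine ⟨1, Or.inr rfl, fun x hx => ?_⟩
  have hx' : (x : ℂ) ≠ 0 := by exact_mod_cast hx
  have hd : (x : ℂ) ^ d ≠ 0 := pow_ne_zero _ hx'
  have h := hrec x hx'
  simp only [walkZeta, hp, Complex.ofReal_div, Complex.ofReal_one]
  by_cases h0 : p (1 / x) = 0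
  · rw [if_pos h0, if_pos (by rw [← h, h0, mul_zero])]
    simp
  · rw [if_neg h0, if_neg (by rw [← h]; exact mul_ne_zero hd h0), OnePoint.map_some]
    congr 1
    rw [← h, neg_neg, zpow_natCast]
    field_simp

theorem explicitAbsZeta_walkZeta (hp : ∀ u, (1 - u • evolution N A).det = p u)
    (hpq : ∀ u, p u * ∏ i, (u ^ m i - 1) = ∏ j, (u ^ n j - 1)) {d : ℕ}
    (hrec : ∀ x : ℂ, x ≠ 0 → x ^ d * p (1 / x) = p x) {D : ℤ} (hd : D = -(d : ℤ))
    (hn : ∀ j, 0 < n j) (hab : a ≤ b) (hpar : Even (a + b))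
    (hD : (D : ℂ) = ∑ i, (m i : ℂ) - ∑ j, (n j : ℂ)) :
    ExplicitAbsZeta (walkZeta N A) m n D := by
  subst hd
  exact explicitAbsZeta_of_quotient hn hab hpar hD (walkZeta_eq_quotient hp hpq)
    (isAbsAutomorphic_walkZeta hp hrec)

theorem explicitAbsZeta_M_two : ExplicitAbsZeta (walkZeta 2 coinM) ![] ![2, 2] (-4) := by
  refine explicitAbsZeta_walkZeta det_walkM_two (fun u => ?_) (d := 4) (fun x hx => ?_)
    (by norm_num) (by decide) (by norm_num) (by decide) ?_
  · simp; ring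
  · field_simp; ring
  · simp; norm_num

theorem explicitAbsZeta_M_four : ExplicitAbsZeta (walkZeta 4 coinM) ![4] ![2, 2, 8] (-8) := by
  refine explicitAbsZeta_walkZeta det_walkM_four (fun u => ?_) (d := 8) (fun x hx => ?_)
    (by norm_num) (by decide) (by norm_num) (by decide) ?_
  · simp [Fin.prod_univ_succ]; ring
  · field_simp; ring
  · simp [Fin.sum_univ_succ]; norm_num

theorem explicitAbsZeta_M_eight : ExplicitAbsZeta (walkZeta 8 coinM) ![4, 4, 4, 6, 6]
    ![2, 2, 2, 2, 8, 12, 12] (-16) := by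
  refine explicitAbsZeta_walkZeta det_walkM_eight (fun u => ?_) (d := 16) (fun x hx => ?_)
    (by norm_num) (by decide) (by norm_num) (by decide) ?_
  · simp [Fin.prod_univ_succ]; ring
  · field_simp; ring
  · simp [Fin.sum_univ_succ]; norm_num

theorem explicitAbsZeta_F_two : ExplicitAbsZeta (walkZeta 2 coinF) ![4] ![8] (-4) := by
  refine explicitAbsZeta_walkZeta det_walkF_two (fun u => ?_) (d := 4) (fun x hx => ?_)
    (by norm_num) (by decide) (by norm_num) (by decide) ?_
  · simp; ring
  · field_simp; ring
  · simp; norm_num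

theorem explicitAbsZeta_F_four : ExplicitAbsZeta (walkZeta 4 coinF) ![2, 2] ![4, 8] (-8) := by
  refine explicitAbsZeta_walkZeta det_walkF_four (fun u => ?_) (d := 8) (fun x hx => ?_)
    (by norm_num) (by decide) (by norm_num) (by decide) ?_
  · simp; ring
  · field_simp; ring
  · simp; norm_num

theorem explicitAbsZeta_F_eight : ExplicitAbsZeta (walkZeta 8 coinF) ![2, 2, 2, 2]
    ![4, 6, 6, 8] (-16) := by
  refine explicitAbsZeta_walkZeta det_walkF_eight (fun u => ?_) (d := 16) (fun x hx => ?_)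
    (by norm_num) (by decide) (by norm_num) (by decide) ?_
  · simp [Fin.prod_univ_succ]; ring
  · field_simp; ring
  · simp [Fin.sum_univ_succ]; norm_num

end WalkZeta

/-! ### The F-type walk on the cycle of length two -/

section GammaFormula

/-- The remainder integral decays as `Re y → ∞`. -/
theorem norm_lapMellin_zero_le {R : ℝ → ℂ} {C : ℝ} (hb : ∀ t : ℝ, 0 < t → ‖R t‖ ≤ C * t ^ (1 : ℤ))
    {y : ℂ} (hy : 0 < y.re) : ‖lapMellin R 0 y‖ ≤ C / y.re := by
  have hint : IntegrableOn (fun t : ℝ => C * Real.exp (-(y.re * t))) (Ioi 0) := by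
    have := (exp_neg_integrableOn_Ioi 0 hy).const_mul C
    simpa only [neg_mul, IntegrableOn] using this
  have hval : ∫ t in Ioi (0 : ℝ), C * Real.exp (-(y.re * t)) = C / y.re := by
    have := Real.integral_rpow_mul_exp_neg_mul_Ioi one_pos hy
    simp only [sub_self, Real.rpow_zero, one_mul, Real.rpow_one, Real.Gamma_one, mul_one] at this
    rw [integral_const_mul, this]
    ring
  rw [← hval]
  refine norm_integral_le_of_norm_le hint ?_
  filter_upwards [ae_restrict_mem measurableSet_Ioi] with t (ht : 0 < t)
  have h0 := hb t ht
  rw [norm_smul, norm_mul, norm_cexp_neg_mul, Complex.norm_cpow_eq_rpow_re_of_pos ht]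
  simp only [zero_sub, Complex.neg_re, Complex.one_re, Real.rpow_neg_one]
  rw [zpow_one] at h0
  calc t⁻¹ * (Real.exp (-(y.re * t)) * ‖R t‖) ≤ t⁻¹ * (Real.exp (-(y.re * t)) * (C * t)) := by
        gcongr
    _ = C * Real.exp (-(y.re * t)) := by field_simp

variable {α : ℕ → ℂ}

theorem lapDeriv_zero_eq (Q : ℝ → ℂ) (α : ℕ → ℂ) (y : ℂ) :
    lapDeriv Q 0 α y = -(α 0 * Complex.log y) + lapMellin (laurentRem Q 0 α 1) 0 y := by
  have h : gammaQuot 0 0 = fun _ => 1 := by funext w; simp [gammaQuot]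
  simp [lapDeriv, h]

theorem expRatio_four_eight {t : ℝ} (ht : 0 < t) :
    expRatio ![4] ![8] t + Complex.exp (-(4 * t)) * expRatio ![4] ![8] t = 1 := by
  have h8 := one_sub_cexp_ne_zero (ω := 8) (by norm_num) ht
  have e : Complex.exp (-((8 : ℝ) * t)) = Complex.exp (-(4 * t)) ^ 2 := by
    rw [← Complex.exp_nat_mul]; congr 1; push_cast; ring
  rw [e] at h8
  have e' : expRatio ![4] ![8] t =
      (1 - Complex.exp (-(4 * t))) * (1 - Complex.exp (-(4 * t)) ^ 2)⁻¹ := by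
    rw [← e]; simp [expRatio]
  rw [e']
  field_simp
  ring

/-- `Z_f(w, s) + Z_f(w, s + 4) = (s + 4)^{-w}`, written with `y = s + 4`. -/
theorem lapCont_add_shift (hα : HasLaurentBound (expRatio ![4] ![8]) 0 α) {y : ℂ}
    (hy : 0 < y.re) (w : ℂ) :
    lapCont (expRatio ![4] ![8]) 0 α w y + lapCont (expRatio ![4] ![8]) 0 α w (y + 4) =
      y ^ (-w) := by
  have hy4 : 0 < (y + 4).re := by simp; linarith
  refine eq_of_analyticAt_of_eq_halfPlane (S := ∅) finite_empty 0
    (F := fun w => lapCont (expRatio ![4] ![8]) 0 α w y +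
      lapCont (expRatio ![4] ![8]) 0 α w (y + 4)) (G := fun w => y ^ (-w))
    (fun z _ => (hα.analyticAt_lapCont hy (by simp)).fun_add
      (hα.analyticAt_lapCont hy4 (by simp)))
    (fun z _ => analyticAt_cpow_neg (ne_zero_of_re_pos hy) z)
    (fun z hz => ?_) (notMem_empty w)
  have hz' : ((0 : ℕ) : ℝ) < z.re := by simpa using hz
  have c1 := (hα.mellinConvergent_and_eq 0 hz' hy).1
  have c2 := (hα.mellinConvergent_and_eq 0 hz' hy4).1
  have hadd : lapMellin (expRatio ![4] ![8]) z y + lapMellin (expRatio ![4] ![8]) z (y + 4) =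
      lapMellin (fun _ => 1) z y := by
    rw [lapMellin, lapMellin, ← (hasMellin_add c1 c2).2]
    refine setIntegral_congr_fun measurableSet_Ioi fun t ht => ?_
    simp only [smul_eq_mul]
    rw [← expRatio_four_eight ht, show -((y + 4) * (t : ℂ)) = -(y * t) + -(4 * t) by ring,
      Complex.exp_add]
    ring
  rw [hα.lapCont_eq_mellin hz' hy, hα.lapCont_eq_mellin hz' hy4, ← mul_add, hadd,
    lapMellin_one hz hy]
  have := Complex.Gamma_ne_zero_of_re_pos hz
  field_simp

theorem exp_lapDeriv_mul_shift (hα : HasLaurentBound (expRatio ![4] ![8]) 0 α) {y : ℂ}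
    (hy : 0 < y.re) :
    Complex.exp (lapDeriv (expRatio ![4] ![8]) 0 α y) *
      Complex.exp (lapDeriv (expRatio ![4] ![8]) 0 α (y + 4)) = y⁻¹ := by
  have hy0 := ne_zero_of_re_pos hy
  have h1 := (hα.hasDerivAt_lapCont_zero hy).fun_add
    (hα.hasDerivAt_lapCont_zero (y := y + 4) (by simp; linarith))
  have h2 : HasDerivAt (fun w : ℂ => y ^ (-w)) (-Complex.log y) 0 := by
    simpa using (hasDerivAt_id (0 : ℂ)).fun_neg.const_cpow (c := y) (Or.inl hy0)
  rw [funext (lapCont_add_shift hα hy)] at h1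
  rw [← Complex.exp_add, h1.unique h2, Complex.exp_neg, Complex.exp_log hy0]

/-- A product formula obtained by iterating `g(y) g(y + 4) = 1 / y`. -/
theorem eq_mul_prod_of_mul_shift {g : ℂ → ℂ} (hg0 : ∀ y, g y ≠ 0)
    (hg : ∀ y : ℂ, 0 < y.re → g y * g (y + 4) = y⁻¹) {y : ℂ} (hy : 0 < y.re) (N : ℕ) :
    g y = g (y + 8 * N) * ∏ j ∈ Finset.range N, ((y + 4) / 8 + j) / (y / 8 + j) := by
  induction N with
  | zero => simp
  | succ N ih =>
    have hN : (0 : ℝ) ≤ N := N.cast_nonneg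
    set z := y + 8 * N with hz
    have hzre : 0 < z.re := by simp [hz]; linarith
    have h1 := hg z hzre
    have h2 := hg (z + 4) (by simp; linarith)
    have hz0 := ne_zero_of_re_pos hzre
    have hz4 : z + 4 ≠ 0 := ne_zero_of_re_pos (by simp; linarith)
    have e1 : y + 8 * ((N + 1 : ℕ) : ℂ) = z + 4 + 4 := by rw [hz]; push_cast; ring
    have e2 : ((y + 4) / 8 + N) / (y / 8 + N) = (z + 4) / z := by
      have : y / 8 + N = z / 8 := by rw [hz]; ring
      rw [this, hz]
      rw [hz] at hz0
      field_simp
      ring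
    have h3 : g z = g (z + 4 + 4) * ((z + 4) / z) := by
      have h4 : g (z + 4) ≠ 0 := hg0 _
      field_simp at h1 h2 ⊢
      refine mul_right_cancel₀ h4 ?_
      linear_combination h1 - h2
    rw [Finset.prod_range_succ, ih, e1, e2, h3]
    ring

/-- The asymptotic behaviour `g(y) ~ y^{-1/2}` along `y + 8ℕ`; the exponent comes from the value
`1 / 2` of `expRatio ![4] ![8]` at `0`. -/
theorem tendsto_exp_lapDeriv (hα : HasLaurentBound (expRatio ![4] ![8]) 0 α) (h0 : α 0 = 1 / 2)
    {y : ℂ} (hy : 0 < y.re) :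
    Tendsto (fun N : ℕ => Complex.exp (lapDeriv (expRatio ![4] ![8]) 0 α
      (y + 8 * ((N + 1 : ℕ) : ℂ))) * (N : ℂ) ^ (1 / 2 : ℂ)) atTop (𝓝 ((8 : ℂ) ^ (-1 / 2 : ℂ))) := by
  obtain ⟨C, hC⟩ := hα.bound 1
  set J : ℂ → ℂ := fun y => lapMellin (laurentRem (expRatio ![4] ![8]) 0 α 1) 0 y with hJ
  have hre : ∀ N : ℕ, (y + 8 * ((N + 1 : ℕ) : ℂ)).re = y.re + 8 * (N + 1) := fun N => by simp
  have hJlim : Tendsto (fun N : ℕ => J (y + 8 * ((N + 1 : ℕ) : ℂ))) atTop (𝓝 0) := by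
    have hlim : Tendsto (fun N : ℕ => C / (y.re + 8 * ((N : ℝ) + 1))) atTop (𝓝 0) := by
      refine Tendsto.div_atTop tendsto_const_nhds (tendsto_atTop_mono (fun N => ?_)
        tendsto_natCast_atTop_atTop)
      have : (0 : ℝ) ≤ N := N.cast_nonneg
      linarith
    refine squeeze_zero_norm (fun N => ?_) hlim
    rw [← hre]
    refine norm_lapMellin_zero_le (by exact_mod_cast hC) ?_
    rw [hre]; positivity
  have hinv : Tendsto (fun N : ℕ => 8 + (y + 8) * ((N : ℂ))⁻¹) atTop (𝓝 8) := by
    have := (tendsto_inv_atTop_nhds_zero_nat (𝕜 := ℂ)).const_mul (y + 8)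
    simpa using this.const_add (8 : ℂ)
  have hlog : Tendsto (fun N : ℕ => Complex.log (8 + (y + 8) * ((N : ℂ))⁻¹)) atTop
      (𝓝 (Complex.log 8)) :=
    (continuousAt_clog (by left; norm_num)).tendsto.comp hinv
  have hmain : Tendsto (fun N : ℕ => Complex.exp (Complex.log (8 + (y + 8) * ((N : ℂ))⁻¹) *
      (-1 / 2) + J (y + 8 * ((N + 1 : ℕ) : ℂ)))) atTop (𝓝 ((8 : ℂ) ^ (-1 / 2 : ℂ))) := by
    rw [Complex.cpow_def_of_ne_zero (by norm_num)]
    have := (hlog.mul_const (-1 / 2 : ℂ)).add hJlim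
    rw [add_zero] at this
    exact (Complex.continuous_exp.tendsto _).comp this
  refine hmain.congr' ?_
  filter_upwards [eventually_gt_atTop 0] with N hN
  have hN' : (0 : ℝ) < N := by exact_mod_cast hN
  have hNc : (N : ℂ) ≠ 0 := by exact_mod_cast hN.ne'
  have hne : y + 8 * ((N + 1 : ℕ) : ℂ) ≠ 0 :=
    ne_zero_of_re_pos (by rw [hre]; positivity)
  have e : y + 8 * ((N + 1 : ℕ) : ℂ) = ((N : ℝ) : ℂ) * (8 + (y + 8) * ((N : ℂ))⁻¹) := by
    push_cast; field_simp; ring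
  have hne2 : 8 + (y + 8) * ((N : ℂ))⁻¹ ≠ 0 := by
    rw [e] at hne; exact right_ne_zero_of_mul hne
  have hl : Complex.log (y + 8 * ((N + 1 : ℕ) : ℂ)) =
      Complex.log N + Complex.log (8 + (y + 8) * ((N : ℂ))⁻¹) := by
    rw [e, Complex.log_ofReal_mul hN' hne2, ← Complex.natCast_log]
  rw [lapDeriv_zero_eq, hl, h0, Complex.cpow_def_of_ne_zero hNc, ← Complex.exp_add]
  congr 1
  simp only [hJ]
  ring

/-- Comparison with Euler's product for `Γ`. -/
theorem exp_lapDeriv_eq_Gamma (hα : HasLaurentBound (expRatio ![4] ![8]) 0 α) (h0 : α 0 = 1 / 2)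
    {y : ℂ} (hy : 0 < y.re) :
    Complex.exp (lapDeriv (expRatio ![4] ![8]) 0 α y) =
      Complex.Gamma (y / 8) / Complex.Gamma ((y + 4) / 8) * (8 : ℂ) ^ (-1 / 2 : ℂ) := by
  set g : ℂ → ℂ := fun y => Complex.exp (lapDeriv (expRatio ![4] ![8]) 0 α y) with hg
  have hprod := fun N => eq_mul_prod_of_mul_shift (g := g) (fun y => Complex.exp_ne_zero _)
    (fun y hy => exp_lapDeriv_mul_shift hα hy) hy N
  have hA : ∀ j : ℕ, y / 8 + j ≠ 0 := fun j => by
    have hj : (0 : ℝ) ≤ j := j.cast_nonneg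
    exact ne_zero_of_re_pos (by
      rw [Complex.add_re, Complex.natCast_re, Complex.div_ofNat_re]
      positivity)
  have hB : ∀ j : ℕ, (y + 4) / 8 + j ≠ 0 := fun j => by
    have hj : (0 : ℝ) ≤ j := j.cast_nonneg
    exact ne_zero_of_re_pos (by
      rw [Complex.add_re, Complex.natCast_re, Complex.div_ofNat_re]
      have : 0 < (y + 4).re := by simp; linarith
      positivity)
  have hGB : Complex.Gamma ((y + 4) / 8) ≠ 0 := by
    refine Complex.Gamma_ne_zero fun j h => hB j ?_
    rw [h]; ring
  have hlim := ((Complex.GammaSeq_tendsto_Gamma (y / 8)).div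
    (Complex.GammaSeq_tendsto_Gamma ((y + 4) / 8)) hGB).mul (tendsto_exp_lapDeriv hα h0 hy)
  refine tendsto_nhds_unique (tendsto_const_nhds.congr' ?_) hlim
  filter_upwards [eventually_gt_atTop 0] with N hN
  have hNc : (N : ℂ) ≠ 0 := by exact_mod_cast hN.ne'
  have hfac : ((N.factorial : ℕ) : ℂ) ≠ 0 := by exact_mod_cast N.factorial_ne_zero
  have hpA : ∏ j ∈ Finset.range (N + 1), (y / 8 + (j : ℂ)) ≠ 0 :=
    Finset.prod_ne_zero_iff.2 fun j _ => hA j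
  have hpB : ∏ j ∈ Finset.range (N + 1), ((y + 4) / 8 + (j : ℂ)) ≠ 0 :=
    Finset.prod_ne_zero_iff.2 fun j _ => hB j
  have hpow : (N : ℂ) ^ ((y + 4) / 8) = (N : ℂ) ^ (y / 8) * (N : ℂ) ^ (1 / 2 : ℂ) := by
    rw [← Complex.cpow_add _ _ hNc]; congr 1; ring
  have hn1 : (N : ℂ) ^ (y / 8) ≠ 0 := by simp [Complex.cpow_eq_zero_iff, hNc]
  have hn2 : (N : ℂ) ^ (1 / 2 : ℂ) ≠ 0 := by simp [Complex.cpow_eq_zero_iff, hNc]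
  change g y = _ / _ * (g _ * _)
  rw [hprod (N + 1), Finset.prod_div_distrib, Complex.GammaSeq, Complex.GammaSeq, hpow]
  field_simp

theorem absZetaHalfPlane_F_two {s : ℂ} (hs : ((-4 : ℤ) : ℝ) < s.re) :
    absZetaHalfPlane (fun x : ℝ => walkZeta 2 coinF x) s =
      Complex.Gamma ((s + 4) / 8) * (Complex.Gamma ((s + 8) / 8))⁻¹ * (8 : ℂ) ^ (-1 / 2 : ℂ) := by
  have hn : ∀ j, 0 < (![8] : Fin 1 → ℕ) j := by decide
  obtain ⟨α, hα, h0⟩ := exists_hasLaurentBound_expRatio (m := ![4]) hn le_rfl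
  have h0' : α 0 = 1 / 2 := by rw [h0 rfl]; simp; norm_num
  have hD : ((-4 : ℤ) : ℂ) = ∑ i, ((![4] : Fin 1 → ℕ) i : ℂ) - ∑ j, ((![8] : Fin 1 → ℕ) j : ℂ) := by
    simp; norm_num
  have hspec := (absHurwitz_spec hn hD explicitAbsZeta_F_two.quotient hα hs).2 0
    (zero_ne_natCast _)
  have hα' : HasLaurentBound (expRatio ![4] ![8]) 0 α := hα
  have hy : 0 < (s - ((-4 : ℤ) : ℂ)).re := by
    rw [Complex.sub_re, Complex.intCast_re]; linarith
  rw [absZetaHalfPlane, hspec.deriv_eq]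
  change Complex.exp (deriv (fun w => lapCont (expRatio ![4] ![8]) 0 α w _) 0) = _
  rw [(hα'.hasDerivAt_lapCont_zero hy).deriv, exp_lapDeriv_eq_Gamma hα' h0' hy, div_eq_mul_inv]
  congr 4 <;> push_cast <;> ring

/-- The right-hand side is meromorphic in `s`, so it suffices to know it on a half-plane. At
`s = -8 - 8k` both sides vanish, `Complex.Gamma` being `0` at its poles. -/
theorem absZeta_F_two (s : ℂ) (hs : ∀ k : ℕ, s ≠ -4 - 8 * (k : ℂ)) :
    absZeta (fun x : ℝ => walkZeta 2 coinF x) s =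
      Complex.Gamma ((s + 4) / 8) / Complex.Gamma ((s + 8) / 8) * (8 : ℂ) ^ (-1 / 2 : ℂ) := by
  have hinv : ∀ (c z : ℂ), AnalyticAt ℂ (fun s => (Complex.Gamma ((s + c) / 8))⁻¹) z := fun c z =>
    (Complex.differentiable_one_div_Gamma.comp
      (f := fun s : ℂ => (s + c) / 8) (by fun_prop)).analyticAt z
  have hmero : ∀ z, MeromorphicAt (fun s => Complex.Gamma ((s + 4) / 8)) z := fun z => by
    simpa using (hinv 4 z).meromorphicAt.fun_inv
  have hana : ∀ z : ℂ, (∀ k : ℕ, z ≠ -4 - 8 * (k : ℂ)) →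
      AnalyticAt ℂ (fun s => Complex.Gamma ((s + 4) / 8)) z := fun z hz => by
    have hne : Complex.Gamma ((z + 4) / 8) ≠ 0 := by
      refine Complex.Gamma_ne_zero fun k h => hz k ?_
      linear_combination 8 * h
    simpa using (hinv 4 z).fun_inv (inv_ne_zero hne)
  have h := meroContinuation_spec
    (F := absZetaHalfPlane (fun x : ℝ => walkZeta 2 coinF x))
    (G := fun s => Complex.Gamma ((s + 4) / 8) * (Complex.Gamma ((s + 8) / 8))⁻¹ *
      (8 : ℂ) ^ (-1 / 2 : ℂ))
    (fun z _ => ((hmero z).fun_mul (hinv 8 z).meromorphicAt).fun_mul (MeromorphicAt.const _ _))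
    ((-4 : ℤ) : ℝ) (fun z hz => ((hana z fun k hk => ?_).fun_mul (hinv 8 z)).fun_mul
      analyticAt_const)
    (fun z hz => (absZetaHalfPlane_F_two hz).symm)
  · rw [div_eq_mul_inv]
    exact (h.2 s (((hana s hs).fun_mul (hinv 8 s)).fun_mul analyticAt_const)).eq_of_nhds
  · have hk0 : (0 : ℝ) ≤ k := k.cast_nonneg
    rw [hk] at hz
    simp at hz
    linarith

theorem absZeta_F_two_reflect (s : ℂ) (hs : ∀ k : ℕ, s ≠ -4 - 8 * (k : ℂ))
    (hs' : ∀ k : ℤ, s ≠ 8 * (k : ℂ)) :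
    absZeta (fun x : ℝ => walkZeta 2 coinF x) (-4 - s) = -Complex.cot (s * (Real.pi : ℂ) / 8) *
      absZeta (fun x : ℝ => walkZeta 2 coinF x) s := by
  rw [absZeta_F_two s hs, absZeta_F_two (-4 - s) fun k hk => hs' k (by
    push_cast; linear_combination -hk)]
  set z := s / 8 with hz
  have e1 : (-4 - s + 4) / 8 = -z := by rw [hz]; ring
  have e2 : (-4 - s + 8) / 8 = 1 - (z + 1 / 2) := by rw [hz]; ring
  have e3 : (s + 4) / 8 = z + 1 / 2 := by rw [hz]; ring
  have e4 : (s + 8) / 8 = 1 - -z := by rw [hz]; ring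
  have e5 : s * (Real.pi : ℂ) / 8 = Real.pi * z := by rw [hz]; ring
  rw [e1, e2, e3, e4, e5, Complex.cot_eq_cos_div_sin]
  have h1 := Complex.Gamma_mul_Gamma_one_sub (-z)
  have h2 := Complex.Gamma_mul_Gamma_one_sub (z + 1 / 2)
  rw [show (Real.pi : ℂ) * -z = -(Real.pi * z) by ring, Complex.sin_neg] at h1
  rw [show (Real.pi : ℂ) * (z + 1 / 2) = Real.pi * z + Real.pi / 2 by ring,
    Complex.sin_add_pi_div_two] at h2
  have hpi : (Real.pi : ℂ) ≠ 0 := by exact_mod_cast Real.pi_ne_zero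
  have hG1 : Complex.Gamma (1 - -z) ≠ 0 := Complex.Gamma_ne_zero fun k h =>
    hs' (-(k + 1)) (by push_cast; linear_combination 8 * h + 8 * hz)
  have hG2 : Complex.Gamma (z + 1 / 2) ≠ 0 := Complex.Gamma_ne_zero fun k h =>
    hs k (by linear_combination 8 * h + 8 * hz)
  have hsin : Complex.sin (Real.pi * z) ≠ 0 := fun h => by
    obtain ⟨k, hk⟩ := Complex.sin_eq_zero_iff.1 h
    refine hs' k ?_
    have : z = k := mul_left_cancel₀ hpi (by rw [hk]; ring)
    rw [← this, hz]; ring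
  by_cases hcos : Complex.cos (Real.pi * z) = 0
  · -- here `1 - (z + 1/2)` is a pole of `Γ`, so that both sides vanish
    rw [hcos, div_zero] at h2
    rw [(mul_eq_zero.1 h2).resolve_left hG2, hcos]
    simp
  · have hG3 : Complex.Gamma (1 - (z + 1 / 2)) ≠ 0 := fun h => by
      rw [h, mul_zero] at h2
      exact div_ne_zero hpi hcos h2.symm
    rw [eq_div_iff (neg_ne_zero.2 hsin)] at h1
    rw [eq_div_iff hcos] at h2
    generalize Complex.Gamma (1 - -z) = G₁ at *
    generalize Complex.Gamma (1 - (z + 1 / 2)) = G₂ at *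
    generalize Complex.Gamma (z + 1 / 2) = G₃ at *
    generalize Complex.sin (Real.pi * z) = S at *
    generalize Complex.cos (Real.pi * z) = T at *
    field_simp
    linear_combination h2 - h1

end GammaFormula

end AbsZeta

end

theorem mainTheorem2 :
    -- M type, N = 2, 4, 8
    AbsZeta.ExplicitAbsZeta (AbsZeta.walkZeta 2 AbsZeta.coinM) ![] ![2, 2] (-4) ∧
    AbsZeta.ExplicitAbsZeta (AbsZeta.walkZeta 4 AbsZeta.coinM) ![4] ![2, 2, 8] (-8) ∧
    AbsZeta.ExplicitAbsZeta (AbsZeta.walkZeta 8 AbsZeta.coinM) ![4, 4, 4, 6, 6]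
      ![2, 2, 2, 2, 8, 12, 12] (-16) ∧
    -- F type, N = 2, 4, 8
    AbsZeta.ExplicitAbsZeta (AbsZeta.walkZeta 2 AbsZeta.coinF) ![4] ![8] (-4) ∧
    (∀ s : ℂ, (∀ k : ℕ, s ≠ -4 - 8 * (k : ℂ)) →
      AbsZeta.absZeta (fun x : ℝ => AbsZeta.walkZeta 2 AbsZeta.coinF x) s =
        Complex.Gamma ((s + 4) / 8) / Complex.Gamma ((s + 8) / 8) * (8 : ℂ) ^ (-1 / 2 : ℂ)) ∧
    (∀ s : ℂ, (∀ k : ℕ, s ≠ -4 - 8 * (k : ℂ)) → (∀ k : ℤ, s ≠ 8 * (k : ℂ)) →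
      AbsZeta.absZeta (fun x : ℝ => AbsZeta.walkZeta 2 AbsZeta.coinF x) (-4 - s) =
        -Complex.cot (s * (Real.pi : ℂ) / 8) *
          AbsZeta.absZeta (fun x : ℝ => AbsZeta.walkZeta 2 AbsZeta.coinF x) s) ∧
    AbsZeta.ExplicitAbsZeta (AbsZeta.walkZeta 4 AbsZeta.coinF) ![2, 2] ![4, 8] (-8) ∧
    AbsZeta.ExplicitAbsZeta (AbsZeta.walkZeta 8 AbsZeta.coinF) ![2, 2, 2, 2]
      ![4, 6, 6, 8] (-16) :=
  ⟨AbsZeta.explicitAbsZeta_M_two, AbsZeta.explicitAbsZeta_M_four, AbsZeta.explicitAbsZeta_M_eight,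
    AbsZeta.explicitAbsZeta_F_two, AbsZeta.absZeta_F_two, AbsZeta.absZeta_F_two_reflect,
    AbsZeta.explicitAbsZeta_F_four, AbsZeta.explicitAbsZeta_F_eight⟩
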